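/- **Setting.** A MWMR register $\mathbf R$ with values in a set $V$ having at least two elements and with initial value $v_0$ is shared by $n\ge 3$ asynchronous processes $p_1,\dots,p_n$, which may crash; each of them may read and write $\mathbf R$. Consider the following implementation of $\mathbf R$ from atomic single-writer registers $Val[1],\dots,Val[n]$ (all processes read $Val[i]$, only $p_i$ writes it). $Val[i]$ contains a pair $(v,ts)$ of a value and a vector timestamp of length $n$, initially $(v_0,[0,\dots,0])$. Each process has a local array $new\_ts$ of length $n$, initially $[\infty,\dots,\infty]$. - *Write of $v$ by $p_k$:* for $i=1,\dots,n$ in this order, $p_k$ reads $Val[i]$ and sets $new\_ts[i]\leftarrow (Val[i].ts)[i]$ if $i\neq k$, and $new\_ts[i]\leftarrow (Val[i].ts)[i]+1$ if $i=k$; then it writes $(v,new\_ts)$ to $Val[k]$, resets $new\_ts$ to $[\infty,\dots,\infty]$, and returns *done*. - *Read by a process:* for $i=1,\dots,n$ in this order, it reads $(v_i,ts_i)$ from $Val[i]$; then it returns $v_j$ (the value in the pair $(v_j,ts_j)$) for some $j$ such that $ts_j$ is the lexicographic maximum of $ts_1,\dots,ts_n$. A history is a finite sequence of invocations and responses of operations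 on $\mathbf R$ and of atomic accesses to the registers $Val[i]$. Let $\mathcal H_n$ be the set of histories of this algorithm. **Definitions.** A *linearization function* for a set $\mathcal H$ of histories maps each $H\in\mathcal H$ to a sequential history $f(H)$ such that: (1) $f(H)$ contains all operations that are complete in $H$, with the responses they have in $H$, and possibly some operations that are pending in $H$, with matching responses added (and no other operations, each at most once); (2) if $o$ and $o'$ are in $f(H)$ and the response of $o$ occurs before the invocation of $o'$ in $H$, then $o$ occurs before $o'$ in $f(H)$; (3) every read in $f(H)$ returns the value written by the last write that occurs before it in $f(H)$, or $v_0$ if there is none. It is a *strong linearization function* if moreover, for all $G,H\in\mathcal H$ such that $G$ is a prefix of $H$, $f(G)$ is a prefix of $f(H)$. It is a *write strong-linearization function* if instead, for all such $G,H$, the sequence of write operations in $f(G)$ is a prefix of the sequence of write operations in $f(H)$. The set $\mathcal H$ (or an algorithm whose set of histories is $\mathcal H$) is *strongly linearizable*, respectively *write strongly-linearizable*, if it has a strong linearization function, respectively a write strong-linearization function. **Claim.** For every $n\ge 3$, the algorithm above is not a strongly linearizable implementation of a MWMR register: $\mathcal H_n$ has no strong linearization function. Moreover, strong linearizability is strictly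 stronger than write strong-linearizability: every strongly linearizable set of histories is write strongly-linearizable, whereas $\mathcal H_n$ is write strongly-linearizable but not strongly linearizable. -/

import Mathlib

namespace RegisterLin

/-- The operations of a read/write register with values in `V`. -/
inductive RegOp (V : Type*) where
  | read : RegOp V
  | write (v : V) : RegOp V

/-- The responses of a register: a read returns a value, a write returns `done`. -/
inductive RegResp (V : Type*) where
  | val (v : V) : RegResp V
  | done : RegResp V

/-- Vector timestamps of length `n`; an entry that is not computed yet is `∞ = ⊤`. -/
abbrev Stamp (n : ℕ) := Fin n → ℕ∞

/-- Contents `(v, ts)` of a shared register `Val[i]`. -/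
abbrev Cell (n : ℕ) (V : Type*) := V × Stamp n

/-- The events of a history of an implementation of a register by `n` processes from shared
registers `Val[i]`, where `Val[p]` is written by process `p` only: invocations and responses
of operations on the implemented register, and atomic accesses to the shared registers. -/
inductive Event (n : ℕ) (V : Type*) where
  /-- process `p` invokes operation `o` on the implemented register -/
  | inv (p : Fin n) (o : RegOp V) : Event n V
  /-- process `p` reads `c` from `Val[i]` -/
  | baseRead (p i : Fin n) (c : Cell n V) : Event n V
  /-- process `p` writes `c` to `Val[p]` -/
  | baseWrite (p : Fin n) (c : Cell n V) : Event n V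
  /-- the operation that `p` is executing returns `r` -/
  | resp (p : Fin n) (r : RegResp V) : Event n V

/-- A (finite) history. -/
abbrev History (n : ℕ) (V : Type*) := List (Event n V)

/-! ### Operations in a history

An operation of a history `H` is identified with the position `k` of its invocation in `H`. -/

/-- In `H`, the operation invoked at position `k` has its response at position `m`, with value
`r`: this is the first response of the same process after position `k`. -/
def RespondsAt {n : ℕ} {V : Type*} (H : History n V) (k m : ℕ) (r : RegResp V) : Prop :=
  ∃ (p : Fin n) (o : RegOp V), H[k]? = some (Event.inv p o) ∧ k < m ∧
    H[m]? = some (Event.resp p r) ∧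
    ∀ j, k < j → j < m → ∀ r', H[j]? ≠ some (Event.resp p r')

/-- The operation invoked at position `k` is complete in `H`. -/
def CompleteIn {n : ℕ} {V : Type*} (H : History n V) (k : ℕ) : Prop :=
  ∃ m r, RespondsAt H k m r

/-- The operation invoked at `k` precedes the one invoked at `k'`: the response of the former
occurs before the invocation of the latter. -/
def Precedes {n : ℕ} {V : Type*} (H : History n V) (k k' : ℕ) : Prop :=
  ∃ m r, RespondsAt H k m r ∧ m < k'

/-! ### Sequential histories and linearization functions -/

/-- An operation with its matching response, as it occurs in a sequential history: a read by
`p` that returns `v`, or a write of `v` by `p` (which returns `done`).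
The number `id` identifies the operation. -/
inductive SeqOp (n : ℕ) (V : Type*) where
  | read (p : Fin n) (id : ℕ) (v : V) : SeqOp n V
  | write (p : Fin n) (id : ℕ) (v : V) : SeqOp n V

namespace SeqOp

variable {n : ℕ} {V : Type*}

/-- The process that executes the operation. -/
def proc : SeqOp n V → Fin n
  | read p _ _ => p
  | write p _ _ => p

/-- The identity of the operation. -/
def ident : SeqOp n V → ℕ
  | read _ k _ => k
  | write _ k _ => k

/-- The operation without its response. -/
def op : SeqOp n V → RegOp V
  | read _ _ _ => RegOp.read
  | write _ _ v => RegOp.write v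

/-- The response of the operation. -/
def resp : SeqOp n V → RegResp V
  | read _ _ v => RegResp.val v
  | write _ _ _ => RegResp.done

/-- Is the operation a write? -/
def isWrite : SeqOp n V → Bool
  | read _ _ _ => false
  | write _ _ _ => true

end SeqOp

/-- A sequential history: a sequence of operations, each with its response. -/
abbrev SeqHistory (n : ℕ) (V : Type*) := List (SeqOp n V)

/-- The value written by the last write in the sequential history `S`, and the initial value
`v₀` if there is no write in `S`. -/
def lastValue {n : ℕ} {V : Type*} (v₀ : V) (S : SeqHistory n V) : V :=
  S.foldl (fun cur e => match e with
    | SeqOp.read _ _ _ => cur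
    | SeqOp.write _ _ v => v) v₀

/-- `S` is a linearization of `H` with respect to the type register with initial value `v₀`. -/
structure IsLinearization {n : ℕ} {V : Type*} (v₀ : V) (H : History n V)
    (S : SeqHistory n V) : Prop where
  /-- no operation occurs twice in `S` -/
  nodup : (S.map SeqOp.ident).Nodup
  /-- every operation in `S` is an operation of `H` -/
  invoked : ∀ e ∈ S, H[e.ident]? = some (Event.inv e.proc e.op)
  /-- an operation that is complete in `H` has in `S` the response that it has in `H` -/
  response : ∀ e ∈ S, ∀ m r, RespondsAt H e.ident m r → e.resp = r
  /-- `S` contains all the operations that are complete in `H` -/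
  complete : ∀ k, CompleteIn H k → ∃ e ∈ S, e.ident = k
  /-- `S` respects the precedence order of `H` -/
  order : ∀ (i j : ℕ) (hi : i < S.length) (hj : j < S.length),
    Precedes H S[i].ident S[j].ident → i < j
  /-- every read in `S` returns the value of the last write that occurs before it in `S`, or the
  initial value if there is none -/
  reads : ∀ (i p k v), S[i]? = some (SeqOp.read p k v) → v = lastValue v₀ (S.take i)

/-- `f` is a linearization function for the set of histories `ℋ`. -/
def IsLinearizationFunction {n : ℕ} {V : Type*} (v₀ : V) (ℋ : Set (History n V))
    (f : History n V → SeqHistory n V) : Prop :=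
  ∀ H ∈ ℋ, IsLinearization v₀ H (f H)

/-- `f` is a strong linearization function for `ℋ`: if `G` is a prefix of `H`, then
`f G` is a prefix of `f H`. -/
def IsStrongLinearizationFunction {n : ℕ} {V : Type*} (v₀ : V) (ℋ : Set (History n V))
    (f : History n V → SeqHistory n V) : Prop :=
  IsLinearizationFunction v₀ ℋ f ∧
    ∀ G ∈ ℋ, ∀ H ∈ ℋ, G <+: H → f G <+: f H

/-- `f` is a write strong-linearization function for `ℋ`: if `G` is a prefix of `H`, then
the sequence of writes in `f G` is a prefix of the sequence of writes in `f H`. -/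
def IsWriteStrongLinearizationFunction {n : ℕ} {V : Type*} (v₀ : V) (ℋ : Set (History n V))
    (f : History n V → SeqHistory n V) : Prop :=
  IsLinearizationFunction v₀ ℋ f ∧
    ∀ G ∈ ℋ, ∀ H ∈ ℋ, G <+: H →
      (f G).filter SeqOp.isWrite <+: (f H).filter SeqOp.isWrite

/-- An algorithm with set of histories `ℋ` is a strongly linearizable implementation of a
register with initial value `v₀`. -/
def StronglyLinearizable {n : ℕ} {V : Type*} (v₀ : V) (ℋ : Set (History n V)) : Prop :=
  ∃ f, IsStrongLinearizationFunction v₀ ℋ f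

/-- An algorithm with set of histories `ℋ` is a write strongly-linearizable implementation of a
register with initial value `v₀`. -/
def WriteStronglyLinearizable {n : ℕ} {V : Type*} (v₀ : V) (ℋ : Set (History n V)) : Prop :=
  ∃ f, IsWriteStrongLinearizationFunction v₀ ℋ f

/-! ### The vector-clock implementation of a MWMR register from atomic SWMR registers -/

namespace VectorClock

/-- The control state of a process. The array `new_ts` equals `[∞, …, ∞]` whenever the process
is not executing a write, so it is recorded during the execution of a write only. -/
inductive Local (n : ℕ) (V : Type*) where
  /-- no operation is being executed -/
  | idle : Local n V
  /-- executing a write of `v`; the first `i` iterations of the loop are done -/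
  | writing (v : V) (i : ℕ) (newTs : Stamp n) : Local n V
  /-- executing a write that has already written to `Val[-]` -/
  | written : Local n V
  /-- executing a read; `cs` is the list of tuples read so far, from `Val[1], Val[2], …` -/
  | reading (cs : List (Cell n V)) : Local n V

/-- A configuration: the contents of the shared registers and the states of the processes. -/
structure Config (n : ℕ) (V : Type*) where
  val : Fin n → Cell n V
  loc : Fin n → Local n V

/-- Initially every `Val[i]` contains `(v₀, [0, …, 0])` and no operation is being executed. -/
def Config.init (n : ℕ) {V : Type*} (v₀ : V) : Config n V where
  val := fun _ => (v₀, fun _ => 0)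
  loc := fun _ => Local.idle

/-- The configuration after process `p` moves to the control state `l`. -/
def Config.setLoc {n : ℕ} {V : Type*} (s : Config n V) (p : Fin n) (l : Local n V) :
    Config n V where
  val := s.val
  loc := Function.update s.loc p l

/-- The configuration after `c` is written to `Val[p]`. -/
def Config.setVal {n : ℕ} {V : Type*} (s : Config n V) (p : Fin n) (c : Cell n V) :
    Config n V where
  val := Function.update s.val p c
  loc := s.loc

/-- `Step s e s'`: in configuration `s` the algorithm can perform the event `e`, which leads to
configuration `s'`. -/
inductive Step {n : ℕ} {V : Type*} : Config n V → Event n V → Config n V → Prop where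
  /-- an idle process starts a write, with `new_ts = [∞, …, ∞]` -/
  | invWrite (s : Config n V) (p : Fin n) (v : V) (h : s.loc p = Local.idle) :
      Step s (Event.inv p (RegOp.write v))
        (s.setLoc p (Local.writing v 0 (fun _ => ⊤)))
  /-- next iteration of the loop of a write: `new_ts[i] ← (Val[i].ts)[i]` if `i ≠ p`, and
  `new_ts[i] ← (Val[i].ts)[i] + 1` if `i = p` -/
  | writeScan (s : Config n V) (p : Fin n) (v : V) (i : Fin n) (ts : Stamp n)
      (h : s.loc p = Local.writing v i ts) :
      Step s (Event.baseRead p i (s.val i))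
        (s.setLoc p (Local.writing v (i + 1)
          (Function.update ts i (if i = p then (s.val i).2 i + 1 else (s.val i).2 i))))
  /-- the loop is finished: `Val[p] ← (v, new_ts)` -/
  | writeStore (s : Config n V) (p : Fin n) (v : V) (ts : Stamp n)
      (h : s.loc p = Local.writing v n ts) :
      Step s (Event.baseWrite p (v, ts)) ((s.setVal p (v, ts)).setLoc p Local.written)
  /-- the write resets `new_ts` and returns `done` -/
  | writeReturn (s : Config n V) (p : Fin n) (h : s.loc p = Local.written) :
      Step s (Event.resp p RegResp.done) (s.setLoc p Local.idle)
  /-- an idle process starts a read -/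
  | invRead (s : Config n V) (p : Fin n) (h : s.loc p = Local.idle) :
      Step s (Event.inv p RegOp.read) (s.setLoc p (Local.reading []))
  /-- next iteration of the loop of a read: `(v_i, ts_i) ← Val[i]` -/
  | readScan (s : Config n V) (p : Fin n) (i : Fin n) (cs : List (Cell n V))
      (h : s.loc p = Local.reading cs) (hi : cs.length = i) :
      Step s (Event.baseRead p i (s.val i))
        (s.setLoc p (Local.reading (cs ++ [s.val i])))
  /-- the loop is finished: the read returns the value of a collected tuple whose timestamp is the
  greatest one in the lexicographic order -/
  | readReturn (s : Config n V) (p : Fin n) (cs : List (Cell n V)) (c : Cell n V)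
      (h : s.loc p = Local.reading cs) (hlen : cs.length = n) (hc : c ∈ cs)
      (hmax : ∀ c' ∈ cs, toLex c'.2 ≤ toLex c.2) :
      Step s (Event.resp p (RegResp.val c.1)) (s.setLoc p Local.idle)

/-- `Run v₀ H s`: from the initial configuration, the algorithm can perform the sequence of
events `H`, which leads to configuration `s`. -/
inductive Run {n : ℕ} {V : Type*} (v₀ : V) : History n V → Config n V → Prop where
  | nil : Run v₀ [] (Config.init n v₀)
  | snoc {H : History n V} {s s' : Config n V} {e : Event n V} :
      Run v₀ H s → Step s e s' → Run v₀ (H ++ [e]) s'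

/-- The set of histories of the algorithm, executed by `n` processes, for a register with
values in `V` and initial value `v₀`. -/
def histories (n : ℕ) {V : Type*} (v₀ : V) : Set (History n V) :=
  {H | ∃ s, Run v₀ H s}

end VectorClock

end RegisterLin

/-! Failure of strong linearizability. A process `p₃` starts a read and collects the initial tuple
from `Val[p₁]`; then `p₁` completes a write of some `v ≠ v₀`. Call this history `G`. If `p₃` goes on
alone, it sees only initial tuples and returns `v₀`. If `p₂` first completes a write of the same
`v`, then `p₃` returns `v`. In the first extension only `v` is written, so the read must be
linearized before the write of `p₁`. That write is complete in `G`, so the prefix property puts the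
read, with response `v₀`, into `f G`, hence into the linearization of the second extension, where it
must return `v`. This is `not_stronglyLinearizable_of_extensions`.

Write strong-linearizability. Writes are committed online, at the moments when a timestamp is
stored. When `p` stores `ts` and its write is not committed yet, all uncommitted pending writes
whose partial timestamp (with `∞` in the entries not computed) is lexicographically below `ts` are
committed, in any order, and then the write of `p`. Two facts about timestamps make this work.
Partial timestamps only decrease as the scan proceeds, so committed writes stay below the bounds
established for them. An uncommitted one nevertheless stays strictly above every stored timestamp
(`StampBounds.lt_scan`), so its write may still be appended later.

The order built so far is a list of blocks: a write, or the initial value, followed by the reads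
that return its value. A read is inserted when it responds, at the end of the block of the tuple
that it returns. This moves no write, so the sequence of writes only grows. It respects precedence
because of `Floor`: when the read is invoked, the maximal stored timestamp `m` strictly exceeds the
stamps of all blocks but the last; the register holding `m` never decreases, so the read returns a
tuple of stamp at least `m`, whose block cannot lie before the one that was then last. Blocks
appended later consist of operations that were pending after the read began.

`Simulates` collects these invariants, `Simulates.step` preserves them under every event while
extending the list of writes, and `exists_prefix_monotone_choice` turns the steps into a function on
histories. -/

namespace RegisterLin

open VectorClock

/-! ### Lexicographic comparison of partially computed timestamps. -/

section Lex

variable {n : ℕ}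

/-- The first difference `d` of `m` and `ts` is at most `i`, because `ts i = ⊤` while `m` is finite.
If `d < i`, the update is invisible. If `d = i` and `m i = b`, all later entries are still `⊤`, so
the comparison holds entrywise, and `hne` rules out equality. -/
theorem toLex_lt_update_of_lt {m ts : Stamp n} {i : Fin n} {b : ℕ∞}
    (h : toLex m < toLex ts) (htop : ∀ j, i ≤ j → ts j = ⊤) (hfin : ∀ j, m j ≠ ⊤)
    (hb : m i ≤ b) (hne : ∃ p, m p < Function.update ts i b p) :
    toLex m < toLex (Function.update ts i b) := by
  obtain ⟨d, hd, hlt⟩ := h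
  simp only [Pi.toLex_apply] at hd hlt
  rcases lt_trichotomy d i with hdi | rfl | hdi
  · refine ⟨d, fun j hj => ?_, ?_⟩
    · simp [Function.update_of_ne (hj.trans hdi).ne, hd j hj]
    · simpa [Function.update_of_ne hdi.ne] using hlt
  · have hlow : ∀ j < d, m j = Function.update ts d b j := fun j hj => by
      rw [Function.update_of_ne hj.ne, hd j hj]
    rcases hb.lt_or_eq with hb | hb
    · exact ⟨d, hlow, by simpa using hb⟩
    · refine lt_of_le_of_ne (Pi.toLex_monotone fun j => ?_) fun heq => ?_
      · rcases lt_trichotomy j d with hj | rfl | hj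
        · exact (hlow j hj).le
        · simpa using hb.le
        · rw [Function.update_of_ne hj.ne', htop j hj.le]; exact le_top
      · obtain ⟨p, hp⟩ := hne
        rw [← toLex.injective heq] at hp
        exact hp.false
  · exact absurd (by rw [hd i hdi, htop i le_rfl]) (hfin i)

theorem toLex_update_le {ts : Stamp n} {i : Fin n} {b : ℕ∞} (h : ts i = ⊤) :
    toLex (Function.update ts i b) ≤ toLex ts := by
  refine Pi.toLex_monotone fun j => ?_
  by_cases hj : j = i
  · subst hj; rw [h]; exact le_top
  · rw [Function.update_of_ne hj]

end Lex

/-! ### Invariants of the timestamps, and determinism of runs. -/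

section ConfigInvariant

variable {n : ℕ} {V : Type*} {v₀ : V}

/-- Bounds on the timestamps in a reachable configuration. -/
structure StampBounds (s : Config n V) : Prop where
  le_diag : ∀ j i, (s.val j).2 i ≤ (s.val i).2 i
  diag_ne_top : ∀ i, (s.val i).2 i ≠ ⊤
  top_of_le : ∀ {p v i ts}, s.loc p = Local.writing v i ts → ∀ j : Fin n, i ≤ j → ts j = ⊤
  own_lt : ∀ {p v i ts}, s.loc p = Local.writing v i ts → (s.val p).2 p < ts p
  own_ne_top : ∀ {p v i ts}, s.loc p = Local.writing v i ts → p < i → ts p ≠ ⊤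
  other_le : ∀ {p v i ts}, s.loc p = Local.writing v i ts →
    ∀ j : Fin n, j < i → j ≠ p → ts j ≤ (s.val j).2 j
  val_lt : ∀ {p v i ts}, s.loc p = Local.writing v i ts → toLex (s.val p).2 < toLex ts

theorem StampBounds.ne_top {s : Config n V} (h : StampBounds s) (j i : Fin n) :
    (s.val j).2 i ≠ ⊤ :=
  ((h.le_diag j i).trans_lt (h.diag_ne_top i).lt_top).ne

theorem StampBounds.store_le {s : Config n V} (h : StampBounds s) {p v ts}
    (hp : s.loc p = Local.writing v n ts) (j : Fin n) (hj : j ≠ p) : ts j ≤ (s.val j).2 j :=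
  h.other_le hp j j.2 hj

theorem lt_top_stamp {m : Stamp n} (p : Fin n) (h : m p ≠ ⊤) :
    toLex m < toLex (fun _ => ⊤ : Stamp n) := by
  refine lt_of_le_of_ne (Pi.toLex_monotone fun j => le_top) fun heq => h ?_
  exact congrFun (toLex.injective heq) p

/-- The timestamp that the next iteration of the loop of a write computes. -/
def scanStamp (s : Config n V) (p i : Fin n) (ts : Stamp n) : Stamp n :=
  Function.update ts i (if i = p then (s.val i).2 i + 1 else (s.val i).2 i)

theorem StampBounds.own_lt_scan {s : Config n V} (h : StampBounds s) {p v} {i : Fin n} {ts}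
    (hp : s.loc p = Local.writing v i ts) : (s.val p).2 p < scanStamp s p i ts p := by
  unfold scanStamp
  by_cases hpi : i = p
  · subst hpi
    simpa using ENat.lt_add_one_iff (h.diag_ne_top i) |>.2 le_rfl
  · rw [Function.update_of_ne (Ne.symm hpi)]
    exact h.own_lt hp

/-- The scanned entry comes from the diagonal, which dominates its column. Strictness comes from
coordinate `p`: the entry of the writer is `⊤` or already incremented, hence above every stored
entry in column `p`. -/
theorem StampBounds.lt_scan {s : Config n V} (h : StampBounds s) {p v} {i : Fin n} {ts}
    (hp : s.loc p = Local.writing v i ts) (j : Fin n)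
    (hlt : toLex (s.val j).2 < toLex ts) : toLex (s.val j).2 < toLex (scanStamp s p i ts) := by
  refine toLex_lt_update_of_lt hlt (fun k hk => h.top_of_le hp k hk) (h.ne_top j) ?_
    ⟨p, (h.le_diag j p).trans_lt (h.own_lt_scan hp)⟩
  split_ifs
  · exact (h.le_diag j i).trans le_self_add
  · exact h.le_diag j i

theorem StampBounds.scan_le {s : Config n V} (h : StampBounds s) {p v} {i : Fin n} {ts}
    (hp : s.loc p = Local.writing v i ts) : toLex (scanStamp s p i ts) ≤ toLex ts :=
  toLex_update_le (h.top_of_le hp i le_rfl)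

theorem StampBounds.setLoc {s : Config n V} (h : StampBounds s) (p : Fin n) {l : Local n V}
    (hl : ∀ v i ts, l ≠ Local.writing v i ts) : StampBounds (s.setLoc p l) := by
  have key : ∀ {q v i ts}, (s.setLoc p l).loc q = Local.writing v i ts →
      s.loc q = Local.writing v i ts := by
    intro q v i ts hq
    by_cases hqp : q = p
    · subst hqp
      simp [Config.setLoc] at hq
      exact absurd hq (hl _ _ _)
    · simpa [Config.setLoc, hqp] using hq
  exact ⟨h.le_diag, h.diag_ne_top, fun hq => h.top_of_le (key hq), fun hq => h.own_lt (key hq),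
    fun hq => h.own_ne_top (key hq), fun hq => h.other_le (key hq), fun hq => h.val_lt (key hq)⟩

theorem StampBounds.setWriting {s : Config n V} (h : StampBounds s) (p : Fin n) {v : V} {i : ℕ}
    {ts : Stamp n} (htop : ∀ j : Fin n, i ≤ j → ts j = ⊤) (hown : (s.val p).2 p < ts p)
    (hfin : p < i → ts p ≠ ⊤) (hother : ∀ j : Fin n, j < i → j ≠ p → ts j ≤ (s.val j).2 j)
    (hval : toLex (s.val p).2 < toLex ts) :
    StampBounds (s.setLoc p (Local.writing v i ts)) := by
  have key : ∀ {q w k t}, (s.setLoc p (Local.writing v i ts)).loc q = Local.writing w k t →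
      s.loc q = Local.writing w k t ∨ q = p ∧ k = i ∧ t = ts := by
    intro q w k t hq
    by_cases hqp : q = p
    · subst hqp
      simp [Config.setLoc] at hq
      exact Or.inr ⟨rfl, hq.2.1.symm, hq.2.2.symm⟩
    · exact Or.inl (by simpa [Config.setLoc, hqp] using hq)
  refine ⟨h.le_diag, h.diag_ne_top, ?_, ?_, ?_, ?_, ?_⟩ <;> intro q w k t hq <;>
    rcases key hq with hq | ⟨rfl, rfl, rfl⟩
  · exact h.top_of_le hq
  · exact htop
  · exact h.own_lt hq
  · exact hown
  · exact h.own_ne_top hq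
  · exact hfin
  · exact h.other_le hq
  · exact hother
  · exact h.val_lt hq
  · exact hval

/-- The new row has a larger diagonal entry, and its other entries were read from diagonal entries,
which never decrease; so the diagonal still dominates each column. -/
theorem StampBounds.store {s : Config n V} (h : StampBounds s) {p : Fin n} {v : V} {ts : Stamp n}
    (hp : s.loc p = Local.writing v n ts) :
    StampBounds ((s.setVal p (v, ts)).setLoc p Local.written) := by
  have hmono : ∀ j, (s.val j).2 j ≤ (Function.update s.val p (v, ts) j).2 j := by
    intro j
    by_cases hj : j = p
    · subst hj; simpa using (h.own_lt hp).le
    · simp [hj]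
  have key : ∀ {q w k t}, ((s.setVal p (v, ts)).setLoc p Local.written).loc q =
      Local.writing w k t → q ≠ p ∧ s.loc q = Local.writing w k t := by
    intro q w k t hq
    by_cases hqp : q = p
    · subst hqp
      simp [Config.setLoc] at hq
    · exact ⟨hqp, by simpa [Config.setLoc, Config.setVal, hqp] using hq⟩
  refine ⟨fun j i => ?_, fun i => ?_, ?_, ?_, ?_, ?_, ?_⟩
  · by_cases hj : j = p
    · subst hj
      by_cases hi : i = j
      · subst hi; rfl
      · simpa [Config.setLoc, Config.setVal, hi] using h.store_le hp i hi
    · refine le_trans ?_ (hmono i)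
      simpa [Config.setLoc, Config.setVal, hj] using h.le_diag j i
  · by_cases hi : i = p
    · subst hi
      simpa [Config.setLoc, Config.setVal] using h.own_ne_top hp i.2
    · simpa [Config.setLoc, Config.setVal, hi] using h.diag_ne_top i
  all_goals
    intro q w k t hq
    obtain ⟨hqp, hq⟩ := key hq
  · exact h.top_of_le hq
  · simpa [Config.setLoc, Config.setVal, hqp] using h.own_lt hq
  · exact h.own_ne_top hq
  · exact fun j hj hjq => (h.other_le hq j hj hjq).trans (hmono j)
  · simpa [Config.setLoc, Config.setVal, hqp] using h.val_lt hq

theorem StampBounds.init (v₀ : V) : StampBounds (Config.init n v₀) := by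
  constructor <;> simp [Config.init]

theorem StampBounds.step {s s' : Config n V} {e : Event n V} (h : StampBounds s)
    (hs : Step s e s') : StampBounds s' := by
  cases hs with
  | invWrite p v hp =>
    exact h.setWriting p (fun _ _ => rfl) (h.diag_ne_top p).lt_top (by simp) (by simp)
      (lt_top_stamp p (h.diag_ne_top p))
  | writeScan p v i ts hp =>
    refine h.setWriting p (ts := scanStamp s p i ts) (fun j hj => ?_) (h.own_lt_scan hp)
      (fun hpi => ?_) (fun j hj hjp => ?_) (h.lt_scan hp p (h.val_lt hp))
    · have hji : j ≠ i := by rintro rfl; omega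
      rw [scanStamp, Function.update_of_ne hji]
      exact h.top_of_le hp j (by omega)
    · by_cases hpi' : i = p
      · subst hpi'
        simp [scanStamp, h.diag_ne_top]
      · rw [scanStamp, Function.update_of_ne (Ne.symm hpi')]
        exact h.own_ne_top hp (by have : (p : ℕ) ≠ i := fun h => hpi' (Fin.ext h.symm); omega)
    · by_cases hji : j = i
      · subst hji
        simp [scanStamp, hjp]
      · rw [scanStamp, Function.update_of_ne hji]
        exact h.other_le hp j (by have : (j : ℕ) ≠ i := fun h => hji (Fin.ext h); omega) hjp
  | writeStore p v ts hp => exact h.store hp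
  | writeReturn p hp => exact h.setLoc p (by simp)
  | invRead p hp => exact h.setLoc p (by simp)
  | readScan p i cs hp hi => exact h.setLoc p (by simp)
  | readReturn p cs c hp hlen hc hmax => exact h.setLoc p (by simp)

/-- Events record the process and the contents accessed, so the only nondeterminism, namely who
moves and which maximal tuple a read returns, is visible in the history or does not affect the next
configuration. -/
theorem VectorClock.Step.unique {s s₁ s₂ : Config n V} {e : Event n V} (h₁ : Step s e s₁)
    (h₂ : Step s e s₂) : s₁ = s₂ := by
  generalize he : e = e' at h₂
  cases h₁ <;> cases h₂ <;> simp_all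

theorem VectorClock.Run.exists_of_snoc {H : History n V} {e : Event n V} {s' : Config n V}
    (h : Run v₀ (H ++ [e]) s') : ∃ s, Run v₀ H s ∧ Step s e s' := by
  generalize hH : H ++ [e] = H' at h
  cases h with
  | nil => simp at hH
  | snoc hr hs =>
    obtain ⟨rfl, h⟩ := List.append_inj' hH rfl
    obtain rfl : e = _ := by simpa using h
    exact ⟨_, hr, hs⟩

theorem VectorClock.Run.unique {H : History n V} {s₁ s₂ : Config n V} (h₁ : Run v₀ H s₁)
    (h₂ : Run v₀ H s₂) : s₁ = s₂ := by
  induction h₁ generalizing s₂ with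
  | nil =>
    generalize hH : ([] : History n V) = H' at h₂
    cases h₂ with
    | nil => rfl
    | snoc => simp at hH
  | snoc _ hs ih =>
    obtain ⟨s, hr, hs'⟩ := h₂.exists_of_snoc
    obtain rfl := ih hr
    exact hs.unique hs'

end ConfigInvariant

/-! ### Operations of a growing history and arrangements of them. -/

section Histories

variable {n : ℕ} {V : Type*} {H : History n V}

theorem RespondsAt.lt_length {k m : ℕ} {r : RegResp V} (h : RespondsAt H k m r) :
    m < H.length := by
  obtain ⟨p, o, -, -, hm, -⟩ := h
  exact (List.getElem?_eq_some_iff.1 hm).1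

theorem RespondsAt.lt {k m : ℕ} {r : RegResp V} (h : RespondsAt H k m r) : k < m := by
  obtain ⟨p, o, -, hkm, -⟩ := h
  exact hkm

theorem RespondsAt.snoc {k m : ℕ} {r : RegResp V} (h : RespondsAt H k m r) (e : Event n V) :
    RespondsAt (H ++ [e]) k m r := by
  have hm := h.lt_length
  obtain ⟨p, o, hk, hkm, hr, hj⟩ := h
  refine ⟨p, o, ?_, hkm, ?_, fun j hkj hjm => ?_⟩
  · rwa [List.getElem?_append_left (by omega)]
  · rwa [List.getElem?_append_left hm]
  · rw [List.getElem?_append_left (by omega)]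
    exact hj j hkj hjm

theorem RespondsAt.of_snoc {k m : ℕ} {r : RegResp V} {e : Event n V}
    (h : RespondsAt (H ++ [e]) k m r) (hm : m < H.length) : RespondsAt H k m r := by
  obtain ⟨p, o, hk, hkm, hr, hj⟩ := h
  refine ⟨p, o, ?_, hkm, ?_, fun j hkj hjm => ?_⟩
  · rwa [List.getElem?_append_left (by omega)] at hk
  · rwa [List.getElem?_append_left hm] at hr
  · have := hj j hkj hjm
    rwa [List.getElem?_append_left (by omega)] at this

theorem precedes_snoc_iff {e : Event n V} {x y : ℕ} (hy : y ≤ H.length) :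
    Precedes (H ++ [e]) x y ↔ Precedes H x y :=
  ⟨fun ⟨m, r, h, hm⟩ => ⟨m, r, h.of_snoc (hm.trans_le hy), hm⟩,
    fun ⟨m, r, h, hm⟩ => ⟨m, r, h.snoc e, hm⟩⟩

theorem Precedes.completeIn {x y : ℕ} (h : Precedes H x y) : CompleteIn H x := by
  obtain ⟨m, r, h, -⟩ := h
  exact ⟨m, r, h⟩

theorem Precedes.lt {x y : ℕ} (h : Precedes H x y) : x < y := by
  obtain ⟨m, r, h, hm⟩ := h
  exact h.lt.trans hm

/-- The operation invoked by `p` at position `k` of `H` is pending. -/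
def Pending (H : History n V) (p : Fin n) (k : ℕ) (o : RegOp V) : Prop :=
  H[k]? = some (Event.inv p o) ∧ ∀ j, k < j → ∀ r, H[j]? ≠ some (Event.resp p r)

theorem Pending.lt_length {p : Fin n} {k : ℕ} {o : RegOp V} (h : Pending H p k o) :
    k < H.length :=
  (List.getElem?_eq_some_iff.1 h.1).1

theorem Pending.not_completeIn {p : Fin n} {k : ℕ} {o : RegOp V} (h : Pending H p k o) :
    ¬ CompleteIn H k := by
  rintro ⟨m, r, q, o', hk, hkm, hm, -⟩
  rw [h.1] at hk
  obtain ⟨rfl, -⟩ : p = q ∧ o = o' := by simpa using hk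
  exact h.2 m hkm r hm

theorem Pending.snoc {p : Fin n} {k : ℕ} {o : RegOp V} (h : Pending H p k o) {e : Event n V}
    (he : ∀ r, e ≠ Event.resp p r) : Pending (H ++ [e]) p k o := by
  have hk := h.lt_length
  refine ⟨?_, fun j hj r => ?_⟩
  · rw [List.getElem?_append_left hk]
    exact h.1
  · rcases lt_trichotomy j H.length with hjl | rfl | hjl
    · rw [List.getElem?_append_left hjl]
      exact h.2 j hj r
    · simpa using he r
    · rw [List.getElem?_eq_none (by simp; omega)]
      simp

theorem pending_snoc_inv (H : History n V) (p : Fin n) (o : RegOp V) :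
    Pending (H ++ [Event.inv p o]) p H.length o :=
  ⟨by simp, fun j hj r => by rw [List.getElem?_eq_none (by simp; omega)]; simp⟩

/-- A process has no pending operation in `H` except possibly the one invoked at `k`. -/
def OnlyPending (H : History n V) (p : Fin n) (k : ℕ) : Prop :=
  ∀ k' o, H[k']? = some (Event.inv p o) → CompleteIn H k' ∨ k' = k

theorem respondsAt_snoc_of_not_resp {e : Event n V} (he : ∀ p r, e ≠ Event.resp p r) {k m : ℕ}
    {r : RegResp V} : RespondsAt (H ++ [e]) k m r ↔ RespondsAt H k m r := by
  refine ⟨fun h => h.of_snoc ?_, fun h => h.snoc e⟩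
  have hm := h.lt_length
  by_contra hlt
  obtain rfl : m = H.length := by simp at hm; omega
  obtain ⟨p, o, -, -, hr, -⟩ := h
  exact he p r (by simpa using hr)

/-- The appended response answers an operation of `p` without an earlier response, and `k` is the
only candidate. -/
theorem respondsAt_snoc_resp {p : Fin n} {k : ℕ} (hk : OnlyPending H p k) {k' m : ℕ}
    {r r' : RegResp V} (h : RespondsAt (H ++ [Event.resp p r]) k' m r') :
    RespondsAt H k' m r' ∨ k' = k ∧ r' = r := by
  by_cases hlt : m < H.length
  · exact Or.inl (h.of_snoc hlt)
  have hm := h.lt_length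
  obtain rfl : m = H.length := by simp at hm; omega
  obtain ⟨q, o, hk', hkm, hr, hj⟩ := h
  obtain ⟨rfl, rfl⟩ : p = q ∧ r = r' := by simpa using hr
  rw [List.getElem?_append_left hkm] at hk'
  refine Or.inr ⟨(hk k' o hk').resolve_left ?_, rfl⟩
  rintro ⟨m', r', h'⟩
  have hm' := h'.lt_length
  obtain ⟨q, o', hk'', hlt', hm'', -⟩ := h'
  rw [hk'] at hk''
  obtain ⟨rfl, -⟩ : p = q ∧ o = o' := by simpa using hk''
  refine hj m' hlt' hm' r' ?_
  rwa [List.getElem?_append_left hm']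

theorem Pending.completeIn_snoc {p : Fin n} {k : ℕ} {o : RegOp V} (h : Pending H p k o)
    (r : RegResp V) : CompleteIn (H ++ [Event.resp p r]) k := by
  have hk := h.lt_length
  refine ⟨H.length, r, p, o, ?_, hk, by simp, fun j hj hjl r' => ?_⟩
  · rw [List.getElem?_append_left hk]
    exact h.1
  · rw [List.getElem?_append_left hjl]
    exact h.2 j hj r'

theorem CompleteIn.snoc {k : ℕ} (h : CompleteIn H k) (e : Event n V) :
    CompleteIn (H ++ [e]) k := by
  obtain ⟨m, r, h⟩ := h
  exact ⟨m, r, h.snoc e⟩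

/-- The part of `IsLinearization` that does not concern the values that reads return. -/
structure IsArrangement (H : History n V) (S : SeqHistory n V) : Prop where
  nodup : (S.map SeqOp.ident).Nodup
  invoked : ∀ e ∈ S, H[e.ident]? = some (Event.inv e.proc e.op)
  response : ∀ e ∈ S, ∀ m r, RespondsAt H e.ident m r → e.resp = r
  complete : ∀ k, CompleteIn H k → ∃ e ∈ S, e.ident = k
  order : S.Pairwise fun x y => ¬ Precedes H y.ident x.ident

theorem IsArrangement.ident_lt {S : SeqHistory n V} (h : IsArrangement H S) {e : SeqOp n V}
    (he : e ∈ S) : e.ident < H.length :=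
  (List.getElem?_eq_some_iff.1 (h.invoked e he)).1

theorem IsArrangement.nil : IsArrangement ([] : History n V) [] := by
  refine ⟨by simp, by simp, by simp, ?_, by simp⟩
  rintro k ⟨m, r, h⟩
  exact absurd h.lt_length (by simp)

theorem IsArrangement.invoked_snoc {S : SeqHistory n V} (h : IsArrangement H S) (e : Event n V)
    {x : SeqOp n V} (hx : x ∈ S) : (H ++ [e])[x.ident]? = some (Event.inv x.proc x.op) := by
  rw [List.getElem?_append_left (h.ident_lt hx)]
  exact h.invoked x hx

theorem IsArrangement.order_snoc {S : SeqHistory n V} (h : IsArrangement H S) (e : Event n V) :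
    S.Pairwise fun x y => ¬ Precedes (H ++ [e]) y.ident x.ident := by
  refine h.order.imp_of_mem fun hx _ hxy => ?_
  rwa [precedes_snoc_iff (h.ident_lt hx).le]

theorem IsArrangement.snoc_of_not_resp {S : SeqHistory n V} (h : IsArrangement H S)
    {e : Event n V} (he : ∀ p r, e ≠ Event.resp p r) : IsArrangement (H ++ [e]) S := by
  refine ⟨h.nodup, fun x hx => h.invoked_snoc e hx, fun x hx m r hr => ?_, fun k => ?_,
    h.order_snoc e⟩
  · exact h.response x hx m r ((respondsAt_snoc_of_not_resp he).1 hr)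
  · rintro ⟨m, r, hr⟩
    exact h.complete k ⟨m, r, (respondsAt_snoc_of_not_resp he).1 hr⟩

/-- A pending operation precedes nothing, so pending operations can be appended in any order. -/
theorem IsArrangement.append_pending {S T : SeqHistory n V} (h : IsArrangement H S)
    (hnd : (T.map SeqOp.ident).Nodup) (hdis : ∀ e ∈ T, ∀ x ∈ S, x.ident ≠ e.ident)
    (hT : ∀ e ∈ T, Pending H e.proc e.ident e.op) : IsArrangement H (S ++ T) := by
  refine ⟨?_, fun x hx => ?_, fun x hx m r hr => ?_, fun k hk => ?_, ?_⟩
  · rw [List.map_append, List.nodup_append']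
    refine ⟨h.nodup, hnd, ?_⟩
    intro k hk hk'
    obtain ⟨x, hx, rfl⟩ := List.mem_map.1 hk
    obtain ⟨e, he, hxe⟩ := List.mem_map.1 hk'
    exact hdis e he x hx hxe.symm
  · rcases List.mem_append.1 hx with hx | hx
    · exact h.invoked x hx
    · exact (hT x hx).1
  · rcases List.mem_append.1 hx with hx | hx
    · exact h.response x hx m r hr
    · exact absurd ⟨m, r, hr⟩ (hT x hx).not_completeIn
  · obtain ⟨e, he, hek⟩ := h.complete k hk
    exact ⟨e, List.mem_append_left _ he, hek⟩
  · have hpend : ∀ e ∈ T, ∀ k, ¬ Precedes H e.ident k := fun e he k hek =>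
      (hT e he).not_completeIn hek.completeIn
    rw [List.pairwise_append]
    refine ⟨h.order, ?_, fun x _ e he => hpend e he _⟩
    exact List.Pairwise.imp_of_mem (R := fun _ _ => True) (fun _ he _ => hpend _ he _)
      (List.pairwise_of_forall fun _ _ => trivial)

theorem IsArrangement.snoc_resp {S : SeqHistory n V} (h : IsArrangement H S) {p : Fin n} {k : ℕ}
    (hk : OnlyPending H p k) {r : RegResp V} (hmem : ∃ e ∈ S, e.ident = k)
    (hr : ∀ e ∈ S, e.ident = k → e.resp = r) : IsArrangement (H ++ [Event.resp p r]) S := by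
  refine ⟨h.nodup, fun x hx => h.invoked_snoc _ hx, fun x hx m r' hr' => ?_, fun k' => ?_,
    h.order_snoc _⟩
  · rcases respondsAt_snoc_resp hk hr' with hr' | ⟨hxk, rfl⟩
    · exact h.response x hx m r' hr'
    · exact hr x hx hxk
  · rintro ⟨m, r', hr'⟩
    rcases respondsAt_snoc_resp hk hr' with hr' | ⟨rfl, rfl⟩
    · exact h.complete k' ⟨m, r', hr'⟩
    · exact hmem

/-- Only the operations placed after `e` can violate the precedence order, since `e` itself is
pending. All other conditions do not depend on the position, and are taken from appending `e` at the
end. -/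
theorem IsArrangement.insert {X Y : SeqHistory n V} (h : IsArrangement H (X ++ Y))
    {e : SeqOp n V} (hinv : Pending H e.proc e.ident e.op) (hne : ∀ x ∈ X ++ Y, x.ident ≠ e.ident)
    (hY : ∀ y ∈ Y, ¬ Precedes H y.ident e.ident) : IsArrangement H (X ++ e :: Y) := by
  have hperm : (X ++ e :: Y).Perm ((X ++ Y) ++ [e]) := by
    rw [List.append_assoc]
    exact (List.perm_append_comm (l₁ := [e]) (l₂ := Y)).append_left X
  have h' : IsArrangement H ((X ++ Y) ++ [e]) :=
    h.append_pending (by simp) (by simpa using hne) (by simpa using hinv)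
  refine ⟨(hperm.map _).nodup_iff.2 h'.nodup, fun x hx => h'.invoked x (hperm.subset hx),
    fun x hx => h'.response x (hperm.subset hx), fun k hk => ?_, ?_⟩
  · obtain ⟨x, hx, hxk⟩ := h'.complete k hk
    exact ⟨x, hperm.symm.subset hx, hxk⟩
  · obtain ⟨hX, hY', hXY⟩ := List.pairwise_append.1 h.order
    refine List.pairwise_append.2 ⟨hX, List.pairwise_cons.2 ⟨hY, hY'⟩, fun x hx y hy => ?_⟩
    rcases List.mem_cons.1 hy with rfl | hy
    · exact fun hp => hinv.not_completeIn hp.completeIn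
    · exact hXY x hx y hy

/-- Every read in `S` returns the value of the last write before it, or `v` if there is none. -/
def ReadsLast (v : V) : SeqHistory n V → Prop
  | [] => True
  | SeqOp.read _ _ w :: S => w = v ∧ ReadsLast v S
  | SeqOp.write _ _ w :: S => ReadsLast w S

theorem ReadsLast.eq_lastValue {v : V} {S : SeqHistory n V} (h : ReadsLast v S) {i : ℕ} {p : Fin n}
    {k : ℕ} {w : V} (hi : S[i]? = some (SeqOp.read p k w)) : w = lastValue v (S.take i) := by
  induction S generalizing v i with
  | nil => simp at hi
  | cons e S ih =>
    cases i with
    | zero =>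
      obtain rfl : e = SeqOp.read p k w := by simpa using hi
      exact h.1
    | succ i =>
      cases e with
      | read q j x =>
        simpa [lastValue] using ih h.2 (by simpa using hi)
      | write q j x =>
        simpa [lastValue] using ih (v := x) h (by simpa using hi)

theorem IsArrangement.isLinearization {v₀ : V} {S : SeqHistory n V} (h : IsArrangement H S)
    (hr : ReadsLast v₀ S) : IsLinearization v₀ H S where
  nodup := h.nodup
  invoked := h.invoked
  response := h.response
  complete := h.complete
  order i j hi hj hij := by
    by_contra hlt
    rcases (not_lt.1 hlt).eq_or_lt with rfl | hji
    · exact hij.lt.false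
    · exact List.pairwise_iff_getElem.1 h.order j i hj hi hji hij
  reads i p k v hi := hr.eq_lastValue hi

end Histories

/-! ### Sequential histories built from blocks. -/

section Blocks

variable {n : ℕ} {V : Type*}

/-- A write in a sequential history under construction (or no write, for the initial value),
with the reads that return its value and the current timestamp of the write. -/
structure Block (n : ℕ) (V : Type*) where
  write : Option (Fin n × ℕ)
  val : V
  stamp : Stamp n
  reads : List (Fin n × ℕ)

/-- The write of a block. -/
def Block.key (b : Block n V) : Option (Fin n × ℕ) × V := (b.write, b.val)

/-- The write, if any, that a key describes. -/
def keyOps (k : Option (Fin n × ℕ) × V) : SeqHistory n V :=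
  k.1.toList.map fun w => SeqOp.write w.1 w.2 k.2

/-- The operations of a block. -/
def Block.ops (b : Block n V) : SeqHistory n V :=
  keyOps b.key ++ b.reads.map fun r => SeqOp.read r.1 r.2 b.val

/-- The sequential history that consists of the given blocks. -/
def seqOf (B : List (Block n V)) : SeqHistory n V := B.flatMap Block.ops

theorem seqOf_append (A B : List (Block n V)) : seqOf (A ++ B) = seqOf A ++ seqOf B :=
  List.flatMap_append

theorem mem_seqOf {B : List (Block n V)} {e : SeqOp n V} :
    e ∈ seqOf B ↔ ∃ b ∈ B, e ∈ b.ops := List.mem_flatMap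

theorem Block.write_mem_ops {b : Block n V} {p : Fin n} {k : ℕ} (h : b.write = some (p, k)) :
    SeqOp.write p k b.val ∈ b.ops := by
  simp [Block.ops, keyOps, Block.key, h]

theorem Block.write_eq_of_mem_ops {b : Block n V} {e : SeqOp n V} {v : V} (he : e ∈ b.ops)
    (hop : e.op = RegOp.write v) : b.write = some (e.proc, e.ident) := by
  simp only [Block.ops, keyOps, Block.key, List.mem_append, List.mem_map, Option.mem_toList] at he
  rcases he with ⟨w, hw, rfl⟩ | ⟨w, hw, rfl⟩
  · exact hw
  · simp [SeqOp.op] at hop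

/-- Inserting reads and changing stamps leave the keys alone, so write strong-linearizability
reduces to a prefix relation between lists of keys. -/
theorem filter_isWrite_seqOf (B : List (Block n V)) :
    (seqOf B).filter SeqOp.isWrite = (B.map Block.key).flatMap keyOps := by
  induction B with
  | nil => rfl
  | cons b B ih =>
    have h₁ : (keyOps b.key).filter SeqOp.isWrite = keyOps b.key := by
      rw [List.filter_eq_self, keyOps, List.forall_mem_map]
      exact fun _ _ => rfl
    have h₂ : (b.reads.map fun r => SeqOp.read r.1 r.2 b.val).filter SeqOp.isWrite = [] := by
      rw [List.filter_eq_nil_iff, List.forall_mem_map]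
      exact fun _ _ => Bool.false_ne_true
    simp only [seqOf] at ih
    simp [seqOf, Block.ops, List.filter_append, h₁, h₂, ih]

/-- A key without a write has the value of the preceding key, or `x` if there is none. -/
def Consistent : V → List (Option (Fin n × ℕ) × V) → Prop
  | _, [] => True
  | x, k :: K => (k.1 = none → k.2 = x) ∧ Consistent k.2 K

theorem Consistent.append {x : V} {K K' : List (Option (Fin n × ℕ) × V)} (h : Consistent x K)
    (h' : ∀ k ∈ K', k.1 ≠ none) : Consistent x (K ++ K') := by
  induction K generalizing x with
  | nil =>
    induction K' generalizing x with
    | nil => trivial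
    | cons k K' ih =>
      exact ⟨fun hk => absurd hk (h' k (by simp)), ih (fun j hj => h' j (by simp [hj])) trivial⟩
  | cons k K ih => exact ⟨h.1, ih h.2⟩

theorem readsLast_reads_append {v : V} {T : SeqHistory n V} (h : ReadsLast v T)
    (L : List (Fin n × ℕ)) : ReadsLast v (L.map (fun r => SeqOp.read r.1 r.2 v) ++ T) := by
  induction L with
  | nil => exact h
  | cons r L ih => exact ⟨rfl, ih⟩

theorem Consistent.readsLast {x : V} {B : List (Block n V)} (h : Consistent x (B.map Block.key)) :
    ReadsLast x (seqOf B) := by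
  induction B generalizing x with
  | nil => trivial
  | cons b B ih =>
    have hB := readsLast_reads_append (ih h.2) b.reads
    have hw := h.1
    simp only [Block.key] at hB hw
    simp only [seqOf, List.flatMap_cons, Block.ops, keyOps, Block.key, List.append_assoc] at hB ⊢
    cases hb : b.write with
    | none =>
      rw [hw hb] at hB ⊢
      exact hB
    | some w => exact hB

end Blocks

/-! ### Control states and pending operations. -/

section Tracking

variable {n : ℕ} {V : Type*}

/-- The operation that a process in a given control state executes. -/
def Executes : Local n V → RegOp V → Prop
  | Local.idle, _ => False
  | Local.writing v _ _, o => o = RegOp.write v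
  | Local.written, o => ∃ v, o = RegOp.write v
  | Local.reading _, o => o = RegOp.read

/-- In `H`, the only pending operation of a process `p` is the one invoked at `id p`, unless `p`
is idle in `s`. -/
structure Tracks (H : History n V) (s : Config n V) (id : Fin n → ℕ) : Prop where
  pending : ∀ p, s.loc p ≠ Local.idle → ∃ o, Executes (s.loc p) o ∧ Pending H p (id p) o
  complete : ∀ p k o, H[k]? = some (Event.inv p o) →
    CompleteIn H k ∨ s.loc p ≠ Local.idle ∧ k = id p

variable {H : History n V} {s : Config n V} {id : Fin n → ℕ}

theorem Tracks.onlyPending (h : Tracks H s id) (p : Fin n) : OnlyPending H p (id p) :=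
  fun k o hk => (h.complete p k o hk).imp_right And.right

theorem Tracks.of_writing (h : Tracks H s id) {p v i ts} (hp : s.loc p = Local.writing v i ts) :
    Pending H p (id p) (RegOp.write v) := by
  obtain ⟨o, ho, hP⟩ := h.pending p (by simp [hp])
  rw [hp] at ho
  exact ho ▸ hP

theorem Tracks.of_written (h : Tracks H s id) {p} (hp : s.loc p = Local.written) :
    ∃ v, Pending H p (id p) (RegOp.write v) := by
  obtain ⟨o, ho, hP⟩ := h.pending p (by simp [hp])
  rw [hp] at ho
  obtain ⟨v, rfl⟩ := ho
  exact ⟨v, hP⟩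

theorem Tracks.of_reading (h : Tracks H s id) {p cs} (hp : s.loc p = Local.reading cs) :
    Pending H p (id p) RegOp.read := by
  obtain ⟨o, ho, hP⟩ := h.pending p (by simp [hp])
  rw [hp] at ho
  exact ho ▸ hP

theorem Tracks.invoke (h : Tracks H s id) {p : Fin n} (hp : s.loc p = Local.idle) {l : Local n V}
    {o : RegOp V} (hl : Executes l o) :
    Tracks (H ++ [Event.inv p o]) (s.setLoc p l) (Function.update id p H.length) := by
  refine ⟨fun q hq => ?_, fun q k o' hk => ?_⟩
  · by_cases hqp : q = p
    · subst hqp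
      exact ⟨o, by simpa [Config.setLoc] using hl, by simpa using pending_snoc_inv H q o⟩
    · simp only [Config.setLoc, Function.update_of_ne hqp] at hq ⊢
      obtain ⟨o', ho', hP⟩ := h.pending q hq
      exact ⟨o', ho', hP.snoc (by simp)⟩
  · rcases lt_trichotomy k H.length with hkl | rfl | hkl
    · rw [List.getElem?_append_left hkl] at hk
      rcases h.complete q k o' hk with hc | ⟨hq, rfl⟩
      · exact Or.inl (hc.snoc _)
      · have hqp : q ≠ p := by rintro rfl; exact hq hp
        exact Or.inr ⟨by simpa [Config.setLoc, hqp] using hq, by simp [hqp]⟩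
    · obtain ⟨rfl, rfl⟩ : p = q ∧ o = o' := by simpa using hk
      refine Or.inr ⟨?_, by simp⟩
      simp only [Config.setLoc, Function.update_self]
      rintro rfl
      exact hl
    · rw [List.getElem?_eq_none (by simp; omega)] at hk
      simp at hk

theorem Tracks.internal (h : Tracks H s id) {e : Event n V} {s' : Config n V}
    (hinv : ∀ p o, e ≠ Event.inv p o) (hresp : ∀ p r, e ≠ Event.resp p r)
    (hidle : ∀ q, s.loc q = Local.idle → s'.loc q = Local.idle)
    (hex : ∀ q o, Executes (s.loc q) o → Executes (s'.loc q) o) : Tracks (H ++ [e]) s' id := by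
  refine ⟨fun q hq => ?_, fun q k o hk => ?_⟩
  · obtain ⟨o, ho, hP⟩ := h.pending q (mt (hidle q) hq)
    exact ⟨o, hex q o ho, hP.snoc (hresp q)⟩
  · rcases lt_trichotomy k H.length with hkl | rfl | hkl
    · rw [List.getElem?_append_left hkl] at hk
      rcases h.complete q k o hk with hc | ⟨hq, rfl⟩
      · exact Or.inl (hc.snoc _)
      · obtain ⟨o', ho', -⟩ := h.pending q hq
        refine Or.inr ⟨fun h0 => ?_, rfl⟩
        have := hex q o' ho'
        rw [h0] at this
        exact this
    · exact absurd (by simpa using hk) (hinv q o)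
    · rw [List.getElem?_eq_none (by simp; omega)] at hk
      simp at hk

theorem Tracks.respond (h : Tracks H s id) {p : Fin n} (hp : s.loc p ≠ Local.idle)
    (r : RegResp V) : Tracks (H ++ [Event.resp p r]) (s.setLoc p Local.idle) id := by
  refine ⟨fun q hq => ?_, fun q k o hk => ?_⟩
  · have hqp : q ≠ p := by rintro rfl; simp [Config.setLoc] at hq
    simp only [Config.setLoc, Function.update_of_ne hqp] at hq ⊢
    obtain ⟨o', ho', hP⟩ := h.pending q hq
    exact ⟨o', ho', hP.snoc (by simp [hqp.symm])⟩
  · rcases lt_trichotomy k H.length with hkl | rfl | hkl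
    · rw [List.getElem?_append_left hkl] at hk
      rcases h.complete q k o hk with hc | ⟨hq, rfl⟩
      · exact Or.inl (hc.snoc _)
      · by_cases hqp : q = p
        · subst hqp
          obtain ⟨o', -, hP⟩ := h.pending q hp
          exact Or.inl (hP.completeIn_snoc r)
        · exact Or.inr ⟨by simpa [Config.setLoc, hqp] using hq, rfl⟩
    · simp at hk
    · rw [List.getElem?_eq_none (by simp; omega)] at hk
      simp at hk

theorem Pending.proc_eq {p q : Fin n} {k : ℕ} {o o' : RegOp V} (h : Pending H p k o)
    (h' : Pending H q k o') : p = q := by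
  have := h.1.symm.trans h'.1
  simp at this
  exact this.1

end Tracking

/-! ### A lower bound on the block from which a pending read returns. -/

section Floor

variable {n : ℕ} {V : Type*} {H : History n V}

/-- The read invoked at `k`, which has collected `cs` so far, can only return the value of a
block that is not followed by an operation that precedes the read. -/
def Floor (H : History n V) (val : Fin n → Cell n V) (B : List (Block n V))
    (cs : List (Cell n V)) (k : ℕ) : Prop :=
  ∃ (a : ℕ) (m : Stamp n) (j : Fin n), a < B.length ∧
    (∀ i b, i < a → B[i]? = some b → toLex b.stamp < toLex m) ∧
    (∀ i b, a < i → B[i]? = some b → ∀ e ∈ b.ops, ¬ Precedes H e.ident k) ∧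
    (∀ c, cs[(j : ℕ)]? = some c → toLex m ≤ toLex c.2) ∧
    (cs.length ≤ j → toLex m ≤ toLex (val j).2)

variable {val : Fin n → Cell n V} {B : List (Block n V)} {cs : List (Cell n V)} {k : ℕ}

theorem Floor.snoc (h : Floor H val B cs k) (hk : k ≤ H.length) (e : Event n V) :
    Floor (H ++ [e]) val B cs k := by
  obtain ⟨a, m, j, ha, h₁, h₂, h₃, h₄⟩ := h
  refine ⟨a, m, j, ha, h₁, fun i b hi hb x hx => ?_, h₃, h₄⟩
  rw [precedes_snoc_iff hk]
  exact h₂ i b hi hb x hx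

/-- Used when a committed write is still scanning: its stamp goes down, which keeps the strict upper
bounds before the floor. -/
theorem Floor.map (h : Floor H val B cs k) {g : Block n V → Block n V}
    (hops : ∀ b, (g b).ops = b.ops) (hle : ∀ b ∈ B, toLex (g b).stamp ≤ toLex b.stamp) :
    Floor H val (B.map g) cs k := by
  obtain ⟨a, m, j, ha, h₁, h₂, h₃, h₄⟩ := h
  refine ⟨a, m, j, by simpa using ha, fun i b hi hb => ?_, fun i b hi hb => ?_, h₃, h₄⟩ <;>
    obtain ⟨b, hb', rfl⟩ : ∃ b', B[i]? = some b' ∧ g b' = b := by simpa using hb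
  · exact (hle b (List.mem_of_getElem? hb')).trans_lt (h₁ i b hi hb')
  · rw [hops]
    exact h₂ i b hi hb'

/-- The stamps of the new blocks play no role, as they all lie after the floor. This is why a batch
of writes can be committed in any order. -/
theorem Floor.append (h : Floor H val B cs k) {T : List (Block n V)}
    (hT : ∀ b ∈ T, ∀ e ∈ b.ops, ¬ Precedes H e.ident k) : Floor H val (B ++ T) cs k := by
  obtain ⟨a, m, j, ha, h₁, h₂, h₃, h₄⟩ := h
  refine ⟨a, m, j, by simp; omega, fun i b hi hb => ?_, fun i b hi hb => ?_, h₃, h₄⟩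
  · rw [List.getElem?_append_left (by omega)] at hb
    exact h₁ i b hi hb
  · by_cases hiB : i < B.length
    · rw [List.getElem?_append_left hiB] at hb
      exact h₂ i b hi hb
    · rw [List.getElem?_append_right (by omega)] at hb
      exact hT b (List.mem_of_getElem? hb)

theorem Floor.set (h : Floor H val B cs k) {i : ℕ} {b b' : Block n V} (hb : B[i]? = some b)
    (hstamp : b'.stamp = b.stamp)
    (hops : ∀ e ∈ b'.ops, e ∈ b.ops ∨ ¬ Precedes H e.ident k) : Floor H val (B.set i b') cs k := by
  obtain ⟨a, m, j, ha, h₁, h₂, h₃, h₄⟩ := h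
  refine ⟨a, m, j, by simpa using ha, fun l c hl hc => ?_, fun l c hl hc => ?_, h₃, h₄⟩ <;>
    rw [List.getElem?_set] at hc <;> split_ifs at hc with hil hlB
  · subst hil
    obtain rfl : b' = c := by simpa using hc
    exact hstamp ▸ h₁ i b hl hb
  · exact h₁ l c hl hc
  · subst hil
    obtain rfl : b' = c := by simpa using hc
    exact fun e he => (hops e he).elim (h₂ i b hl hb e) _root_.id
  · exact h₂ l c hl hc

theorem Floor.mono_val (h : Floor H val B cs k) {val' : Fin n → Cell n V}
    (hle : ∀ j, toLex (val j).2 ≤ toLex (val' j).2) : Floor H val' B cs k := by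
  obtain ⟨a, m, j, ha, h₁, h₂, h₃, h₄⟩ := h
  exact ⟨a, m, j, ha, h₁, h₂, h₃, fun hj => (h₄ hj).trans (hle j)⟩

end Floor

/-! ### Preservation of the simulation invariant under each kind of event. -/

section Simulation

variable {n : ℕ} {V : Type*}

/-- The invariant that relates a reachable configuration to the sequential history `seqOf B`
constructed so far; `id p` is the position of the last invocation of `p`. -/
structure Simulates (v₀ : V) (H : History n V) (s : Config n V) (id : Fin n → ℕ)
    (B : List (Block n V)) : Prop where
  bounds : StampBounds s
  tracks : Tracks H s id
  arrangement : IsArrangement H (seqOf B)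
  consistent : Consistent v₀ (B.map Block.key)
  ne_nil : B ≠ []
  top : ∃ m : Stamp n, (∃ j, (s.val j).2 = m) ∧ (∀ j, toLex (s.val j).2 ≤ toLex m) ∧
    (∀ b ∈ B, toLex b.stamp ≤ toLex m) ∧
    ∀ i b, B[i]? = some b → i + 1 < B.length → toLex b.stamp < toLex m
  uncommitted : ∀ {p v i ts}, s.loc p = Local.writing v i ts →
    (∀ b ∈ B, b.write ≠ some (p, id p)) → ∀ b ∈ B, toLex b.stamp < toLex ts
  committed : ∀ {p v i ts}, s.loc p = Local.writing v i ts →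
    ∀ b ∈ B, b.write = some (p, id p) → b.stamp = ts
  cell : ∀ c, ((∃ j, s.val j = c) ∨ ∃ p cs, s.loc p = Local.reading cs ∧ c ∈ cs) →
    ∃ b ∈ B, b.val = c.1 ∧ b.stamp = c.2 ∧
      ∀ q v i ts, s.loc q = Local.writing v i ts → b.write ≠ some (q, id q)
  written : ∀ p, s.loc p = Local.written → ∃ b ∈ B, b.write = some (p, id p)
  read_new : ∀ {p cs}, s.loc p = Local.reading cs → ∀ e ∈ seqOf B, e.ident ≠ id p
  floor : ∀ {p cs}, s.loc p = Local.reading cs → Floor H s.val B cs (id p)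

variable {v₀ : V} {H : History n V} {s : Config n V} {id : Fin n → ℕ} {B : List (Block n V)}

theorem setLoc_loc_self (s : Config n V) (p : Fin n) (l : Local n V) :
    (s.setLoc p l).loc p = l := by simp [Config.setLoc]

theorem setLoc_loc_of_ne (s : Config n V) {p q : Fin n} (l : Local n V) (h : q ≠ p) :
    (s.setLoc p l).loc q = s.loc q := by simp [Config.setLoc, h]

theorem setLoc_loc_eq {s : Config n V} {p q : Fin n} {l l' : Local n V}
    (h : (s.setLoc p l).loc q = l') : q = p ∧ l = l' ∨ q ≠ p ∧ s.loc q = l' := by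
  by_cases hqp : q = p
  · subst hqp
    exact Or.inl ⟨rfl, by simpa [Config.setLoc] using h⟩
  · exact Or.inr ⟨hqp, by simpa [Config.setLoc, hqp] using h⟩

theorem IsArrangement.invoked_block (h : IsArrangement H (seqOf B)) {b : Block n V} (hb : b ∈ B)
    {p : Fin n} {k : ℕ} (hk : b.write = some (p, k)) :
    H[k]? = some (Event.inv p (RegOp.write b.val)) :=
  h.invoked _ (mem_seqOf.2 ⟨b, hb, Block.write_mem_ops hk⟩)

theorem IsArrangement.block_lt (h : IsArrangement H (seqOf B)) {b : Block n V} (hb : b ∈ B)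
    {p : Fin n} {k : ℕ} (hk : b.write = some (p, k)) : k < H.length :=
  (List.getElem?_eq_some_iff.1 (h.invoked_block hb hk)).1

theorem IsArrangement.exists_block (h : IsArrangement H (seqOf B)) {e : SeqOp n V}
    (he : e ∈ seqOf B) {p : Fin n} {v : V} (hp : H[e.ident]? = some (Event.inv p (RegOp.write v))) :
    ∃ b ∈ B, b.write = some (p, e.ident) := by
  have := (h.invoked e he).symm.trans hp
  simp only [Option.some.injEq, Event.inv.injEq] at this
  obtain ⟨b, hb, heb⟩ := mem_seqOf.1 he
  exact ⟨b, hb, by rw [← this.1]; exact Block.write_eq_of_mem_ops heb this.2⟩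

theorem Simulates.init (v₀ : V) (hn : 0 < n) (id : Fin n → ℕ) :
    Simulates v₀ [] (Config.init n v₀) id [⟨none, v₀, fun _ => 0, []⟩] where
  bounds := StampBounds.init v₀
  tracks := ⟨by simp [Config.init], by simp⟩
  arrangement := by simpa [seqOf, Block.ops, keyOps, Block.key] using IsArrangement.nil
  consistent := ⟨fun _ => rfl, trivial⟩
  ne_nil := by simp
  top := ⟨fun _ => 0, ⟨⟨0, hn⟩, rfl⟩, fun _ => le_rfl, by simp, by simp⟩
  uncommitted := by simp [Config.init]
  committed := by simp [Config.init]
  cell := by simp [Config.init]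
  written := by simp [Config.init]
  read_new := by simp [Config.init]
  floor := by simp [Config.init]

theorem Simulates.invWrite (h : Simulates v₀ H s id B) {p : Fin n} {v : V}
    (hp : s.loc p = Local.idle) :
    Simulates v₀ (H ++ [Event.inv p (RegOp.write v)])
      (s.setLoc p (Local.writing v 0 fun _ => ⊤)) (Function.update id p H.length) B where
  bounds := h.bounds.step (Step.invWrite s p v hp)
  tracks := h.tracks.invoke hp rfl
  arrangement := h.arrangement.snoc_of_not_resp (by simp)
  consistent := h.consistent
  ne_nil := h.ne_nil
  top := h.top
  uncommitted {q w i ts} hq hu b hb := by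
    rcases setLoc_loc_eq hq with ⟨rfl, hl⟩ | ⟨hqp, hq⟩
    · obtain ⟨-, -, rfl⟩ := by simpa using hl
      -- Every block is bounded by a stored timestamp, which is finite and so below `[∞, …, ∞]`.
      obtain ⟨m, ⟨j, rfl⟩, -, hm, -⟩ := h.top
      exact (hm b hb).trans_lt (lt_top_stamp q (h.bounds.ne_top j q))
    · exact h.uncommitted hq (by simpa [hqp] using hu) b hb
  committed {q w i ts} hq b hb hbq := by
    rcases setLoc_loc_eq hq with ⟨rfl, hl⟩ | ⟨hqp, hq⟩
    · exact absurd (h.arrangement.block_lt hb hbq) (by simp)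
    · exact h.committed hq b hb (by simpa [hqp] using hbq)
  cell c hc := by
    obtain ⟨b, hb, hv, hs, hw⟩ := h.cell c <| hc.imp_right fun ⟨q, cs, hq, hcs⟩ => by
      rcases setLoc_loc_eq hq with ⟨rfl, hl⟩ | ⟨-, hq⟩
      · simp at hl
      · exact ⟨q, cs, hq, hcs⟩
    refine ⟨b, hb, hv, hs, fun q w i ts hq hbq => ?_⟩
    rcases setLoc_loc_eq hq with ⟨rfl, hl⟩ | ⟨hqp, hq⟩
    · exact absurd (h.arrangement.block_lt hb hbq) (by simp)
    · exact hw q w i ts hq (by simpa [hqp] using hbq)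
  written q hq := by
    rcases setLoc_loc_eq hq with ⟨rfl, hl⟩ | ⟨hqp, hq⟩
    · simp at hl
    · simpa [hqp] using h.written q hq
  read_new {q cs} hq := by
    rcases setLoc_loc_eq hq with ⟨rfl, hl⟩ | ⟨hqp, hq⟩
    · simp at hl
    · simpa [hqp] using h.read_new hq
  floor {q cs} hq := by
    rcases setLoc_loc_eq hq with ⟨rfl, hl⟩ | ⟨hqp, hq⟩
    · simp at hl
    · rw [Function.update_of_ne hqp]
      exact (h.floor hq).snoc (h.tracks.of_reading hq).lt_length.le _

theorem Simulates.invRead (h : Simulates v₀ H s id B) {p : Fin n} (hp : s.loc p = Local.idle) :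
    Simulates v₀ (H ++ [Event.inv p RegOp.read])
      (s.setLoc p (Local.reading [])) (Function.update id p H.length) B where
  bounds := h.bounds.step (Step.invRead s p hp)
  tracks := h.tracks.invoke hp rfl
  arrangement := h.arrangement.snoc_of_not_resp (by simp)
  consistent := h.consistent
  ne_nil := h.ne_nil
  top := h.top
  uncommitted {q w i ts} hq hu b hb := by
    rcases setLoc_loc_eq hq with ⟨rfl, hl⟩ | ⟨hqp, hq⟩
    · simp at hl
    · exact h.uncommitted hq (by simpa [hqp] using hu) b hb
  committed {q w i ts} hq b hb hbq := by
    rcases setLoc_loc_eq hq with ⟨rfl, hl⟩ | ⟨hqp, hq⟩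
    · simp at hl
    · exact h.committed hq b hb (by simpa [hqp] using hbq)
  cell c hc := by
    obtain ⟨b, hb, hv, hs, hw⟩ := h.cell c <| hc.imp_right fun ⟨q, cs, hq, hcs⟩ => by
      rcases setLoc_loc_eq hq with ⟨rfl, hl⟩ | ⟨-, hq⟩
      · obtain rfl : [] = cs := by simpa using hl
        simp at hcs
      · exact ⟨q, cs, hq, hcs⟩
    refine ⟨b, hb, hv, hs, fun q w i ts hq hbq => ?_⟩
    rcases setLoc_loc_eq hq with ⟨rfl, hl⟩ | ⟨hqp, hq⟩
    · simp at hl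
    · exact hw q w i ts hq (by simpa [hqp] using hbq)
  written q hq := by
    rcases setLoc_loc_eq hq with ⟨rfl, hl⟩ | ⟨hqp, hq⟩
    · simp at hl
    · simpa [hqp] using h.written q hq
  read_new {q cs} hq e he := by
    rcases setLoc_loc_eq hq with ⟨rfl, hl⟩ | ⟨hqp, hq⟩
    · simpa using (h.arrangement.ident_lt he).ne
    · simpa [hqp] using h.read_new hq e he
  floor {q cs} hq := by
    rcases setLoc_loc_eq hq with ⟨rfl, hl⟩ | ⟨hqp, hq⟩
    · obtain rfl : [] = cs := by simpa using hl
      obtain ⟨m, ⟨j, rfl⟩, hj, hm, hlt⟩ := h.top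
      have hB := List.length_pos_iff.2 h.ne_nil
      -- The floor of a new read is the last block, witnessed by a register that holds the maximal
      -- timestamp.
      refine ⟨B.length - 1, _, j, by omega, fun i b hi hb => hlt i b hb (by omega),
        fun i b hi hb => ?_, by simp, fun _ => le_rfl⟩
      rw [List.getElem?_eq_none (by omega)] at hb
      simp at hb
    · rw [Function.update_of_ne hqp]
      exact (h.floor hq).snoc (h.tracks.of_reading hq).lt_length.le _

theorem Simulates.writeReturn (h : Simulates v₀ H s id B) {p : Fin n}
    (hp : s.loc p = Local.written) :
    Simulates v₀ (H ++ [Event.resp p RegResp.done]) (s.setLoc p Local.idle) id B where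
  bounds := h.bounds.step (Step.writeReturn s p hp)
  tracks := h.tracks.respond (by simp [hp]) _
  arrangement := by
    obtain ⟨b, hb, hbp⟩ := h.written p hp
    obtain ⟨v, hP⟩ := h.tracks.of_written hp
    refine h.arrangement.snoc_resp (h.tracks.onlyPending p)
      ⟨_, mem_seqOf.2 ⟨b, hb, Block.write_mem_ops hbp⟩, rfl⟩ fun e he hep => ?_
    have := (h.arrangement.invoked e he).symm.trans (hep ▸ hP.1)
    cases e <;> simp_all [SeqOp.op, SeqOp.resp]
  consistent := h.consistent
  ne_nil := h.ne_nil
  top := h.top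
  uncommitted {q w i ts} hq := by
    rcases setLoc_loc_eq hq with ⟨rfl, hl⟩ | ⟨hqp, hq⟩
    · simp at hl
    · exact h.uncommitted hq
  committed {q w i ts} hq := by
    rcases setLoc_loc_eq hq with ⟨rfl, hl⟩ | ⟨hqp, hq⟩
    · simp at hl
    · exact h.committed hq
  cell c hc := by
    obtain ⟨b, hb, hv, hs, hw⟩ := h.cell c <| hc.imp_right fun ⟨q, cs, hq, hcs⟩ => by
      rcases setLoc_loc_eq hq with ⟨rfl, hl⟩ | ⟨-, hq⟩
      · simp at hl
      · exact ⟨q, cs, hq, hcs⟩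
    refine ⟨b, hb, hv, hs, fun q w i ts hq => ?_⟩
    rcases setLoc_loc_eq hq with ⟨rfl, hl⟩ | ⟨hqp, hq⟩
    · simp at hl
    · exact hw q w i ts hq
  written q hq := by
    rcases setLoc_loc_eq hq with ⟨rfl, hl⟩ | ⟨hqp, hq⟩
    · simp at hl
    · exact h.written q hq
  read_new {q cs} hq := by
    rcases setLoc_loc_eq hq with ⟨rfl, hl⟩ | ⟨hqp, hq⟩
    · simp at hl
    · exact h.read_new hq
  floor {q cs} hq := by
    rcases setLoc_loc_eq hq with ⟨rfl, hl⟩ | ⟨hqp, hq⟩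
    · simp at hl
    · exact (h.floor hq).snoc (h.tracks.of_reading hq).lt_length.le _

theorem Simulates.readScan (h : Simulates v₀ H s id B) {p i : Fin n} {cs : List (Cell n V)}
    (hp : s.loc p = Local.reading cs) (hi : cs.length = i) :
    Simulates v₀ (H ++ [Event.baseRead p i (s.val i)])
      (s.setLoc p (Local.reading (cs ++ [s.val i]))) id B where
  bounds := h.bounds.step (Step.readScan s p i cs hp hi)
  tracks := by
    refine h.tracks.internal (by simp) (by simp) (fun q hq => ?_) fun q o hq => ?_ <;>
    · by_cases hqp : q = p
      · subst hqp
        simp_all [Executes, setLoc_loc_self]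
      · rwa [setLoc_loc_of_ne _ _ hqp]
  arrangement := h.arrangement.snoc_of_not_resp (by simp)
  consistent := h.consistent
  ne_nil := h.ne_nil
  top := h.top
  uncommitted {q w i ts} hq := by
    rcases setLoc_loc_eq hq with ⟨rfl, hl⟩ | ⟨hqp, hq⟩
    · simp at hl
    · exact h.uncommitted hq
  committed {q w i ts} hq := by
    rcases setLoc_loc_eq hq with ⟨rfl, hl⟩ | ⟨hqp, hq⟩
    · simp at hl
    · exact h.committed hq
  cell c hc := by
    obtain ⟨b, hb, hv, hs, hw⟩ := h.cell c <| by
      rcases hc with hc | ⟨q, cs', hq, hcs⟩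
      · exact Or.inl hc
      rcases setLoc_loc_eq hq with ⟨rfl, hl⟩ | ⟨-, hq⟩
      · obtain rfl : cs ++ [s.val i] = cs' := by simpa using hl
        rcases List.mem_append.1 hcs with hcs | hcs
        · exact Or.inr ⟨q, cs, hp, hcs⟩
        · exact Or.inl ⟨i, (List.mem_singleton.1 hcs).symm⟩
      · exact Or.inr ⟨q, cs', hq, hcs⟩
    refine ⟨b, hb, hv, hs, fun q w i ts hq => ?_⟩
    rcases setLoc_loc_eq hq with ⟨rfl, hl⟩ | ⟨hqp, hq⟩
    · simp at hl
    · exact hw q w i ts hq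
  written q hq := by
    rcases setLoc_loc_eq hq with ⟨rfl, hl⟩ | ⟨hqp, hq⟩
    · simp at hl
    · exact h.written q hq
  read_new {q cs'} hq := by
    rcases setLoc_loc_eq hq with ⟨rfl, hl⟩ | ⟨hqp, hq⟩
    · exact h.read_new hp
    · exact h.read_new hq
  floor {q cs'} hq := by
    rcases setLoc_loc_eq hq with ⟨rfl, hl⟩ | ⟨hqp, hq⟩
    · obtain rfl : cs ++ [s.val i] = cs' := by simpa using hl
      obtain ⟨a, m, j, ha, h₁, h₂, h₃, h₄⟩ :=
        (h.floor hp).snoc (h.tracks.of_reading hp).lt_length.le (Event.baseRead q i (s.val i))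
      refine ⟨a, m, j, ha, h₁, h₂, fun c hc => ?_, fun hj => h₄ ?_⟩
      · rcases lt_trichotomy (j : ℕ) cs.length with hj | hj | hj
        · rw [List.getElem?_append_left hj] at hc
          exact h₃ c hc
        -- The witness register is read now, so the bound on its contents becomes a bound on a
        -- collected tuple.
        · obtain rfl : j = i := Fin.ext (hj.trans hi)
          obtain rfl : s.val j = c := by simpa [hj] using hc
          exact h₄ hj.ge
        · rw [List.getElem?_eq_none (by simp; omega)] at hc
          simp at hc
      · simp at hj
        omega
    · exact (h.floor hq).snoc (h.tracks.of_reading hq).lt_length.le _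

/-- If the write is already committed, its block follows the new, smaller stamp. If not, the new
stamp must stay above all blocks; these are bounded by a stored timestamp, so `StampBounds.lt_scan`
applies. -/
theorem Simulates.writeScan (h : Simulates v₀ H s id B) {p i : Fin n} {v : V} {ts : Stamp n}
    (hp : s.loc p = Local.writing v i ts) :
    ∃ B' : List (Block n V), B'.map Block.key = B.map Block.key ∧
      Simulates v₀ (H ++ [Event.baseRead p i (s.val i)])
        (s.setLoc p (Local.writing v (i + 1) (scanStamp s p i ts))) id B' := by
  classical
  let g : Block n V → Block n V := fun b =>
    if b.write = some (p, id p) then { b with stamp := scanStamp s p i ts } else b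
  have gwrite : ∀ b, (g b).write = b.write := fun b => by dsimp only [g]; split_ifs <;> rfl
  have gkey : ∀ b, (g b).key = b.key := fun b => by dsimp only [g]; split_ifs <;> rfl
  have gops : ∀ b, (g b).ops = b.ops := fun b => by dsimp only [g]; split_ifs <;> rfl
  have gne : ∀ b, b.write ≠ some (p, id p) → g b = b := fun b hb => if_neg hb
  have gle : ∀ b ∈ B, toLex (g b).stamp ≤ toLex b.stamp := fun b hb => by
    by_cases hbp : b.write = some (p, id p)
    · rw [h.committed hp b hb hbp]
      simpa only [g, if_pos hbp] using h.bounds.scan_le hp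
    · rw [gne b hbp]
  have gseq : seqOf (B.map g) = seqOf B := by
    simp only [seqOf, List.flatMap_map, gops]
  refine ⟨B.map g, by simp [gkey], ?_⟩
  exact
  { bounds := h.bounds.step (Step.writeScan s p v i ts hp)
    tracks := by
      refine h.tracks.internal (by simp) (by simp) (fun q hq => ?_) fun q o hq => ?_ <;>
      · by_cases hqp : q = p
        · subst hqp
          simp_all [Executes, setLoc_loc_self]
        · rwa [setLoc_loc_of_ne _ _ hqp]
    arrangement := by
      rw [gseq]
      exact h.arrangement.snoc_of_not_resp (by simp)
    consistent := by simpa [Function.comp_def, gkey] using h.consistent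
    ne_nil := by simpa using h.ne_nil
    top := by
      obtain ⟨m, hj, hm, hB, hlt⟩ := h.top
      refine ⟨m, hj, hm, fun b' hb' => ?_, fun k b' hb' hk => ?_⟩
      · obtain ⟨b, hb, rfl⟩ := List.mem_map.1 hb'
        exact (gle b hb).trans (hB b hb)
      · obtain ⟨b, hb, rfl⟩ : ∃ b, B[k]? = some b ∧ g b = b' := by simpa using hb'
        exact (gle b (List.mem_of_getElem? hb)).trans_lt (hlt k b hb (by simpa using hk))
    uncommitted := by
      intro q w k t hq hu b' hb'
      have hu' : ∀ b ∈ B, b.write ≠ some (q, id q) := fun b hb => by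
        rw [← gwrite]
        exact hu _ (List.mem_map_of_mem hb)
      obtain ⟨b, hb, rfl⟩ := List.mem_map.1 hb'
      rcases setLoc_loc_eq hq with ⟨rfl, hl⟩ | ⟨hqp, hq⟩
      · obtain ⟨-, -, rfl⟩ := by simpa using hl
        rw [gne b (hu' b hb)]
        obtain ⟨m, ⟨j, rfl⟩, hm, hB, -⟩ := h.top
        refine (hB b hb).trans_lt (h.bounds.lt_scan hp j ?_)
        obtain ⟨c, hc, -, hcs, -⟩ := h.cell (s.val j) (Or.inl ⟨j, rfl⟩)
        exact hcs ▸ h.uncommitted hp hu' c hc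
      · exact (gle b hb).trans_lt (h.uncommitted hq hu' b hb)
    committed := by
      intro q w k t hq b' hb' hbq
      obtain ⟨b, hb, rfl⟩ := List.mem_map.1 hb'
      rw [gwrite] at hbq
      rcases setLoc_loc_eq hq with ⟨rfl, hl⟩ | ⟨hqp, hq⟩
      · obtain ⟨-, -, rfl⟩ := by simpa using hl
        simp only [g, if_pos hbq]
      · rw [gne b (by simp [hbq, hqp])]
        exact h.committed hq b hb hbq
    cell := fun c hc => by
      obtain ⟨b, hb, hv, hs, hw⟩ := h.cell c <| hc.imp_right fun ⟨q, cs, hq, hcs⟩ => by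
        rcases setLoc_loc_eq hq with ⟨rfl, hl⟩ | ⟨-, hq⟩
        · simp at hl
        · exact ⟨q, cs, hq, hcs⟩
      refine ⟨b, ?_, hv, hs, fun q w k t hq => ?_⟩
      -- The block of a tuple in a register or in a collection does not belong to a write still
      -- scanning, so its stamp is final.
      · rw [← gne b (hw p v i ts hp)]
        exact List.mem_map_of_mem hb
      · rcases setLoc_loc_eq hq with ⟨rfl, hl⟩ | ⟨hqp, hq⟩
        · exact hw q _ _ _ hp
        · exact hw q w k t hq
    written := fun q hq => by
      rcases setLoc_loc_eq hq with ⟨rfl, hl⟩ | ⟨hqp, hq⟩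
      · simp at hl
      · obtain ⟨b, hb, hbq⟩ := h.written q hq
        exact ⟨g b, List.mem_map_of_mem hb, by rw [gwrite, hbq]⟩
    read_new := by
      intro q cs hq
      rw [gseq]
      rcases setLoc_loc_eq hq with ⟨rfl, hl⟩ | ⟨hqp, hq⟩
      · simp at hl
      · exact h.read_new hq
    floor := by
      intro q cs hq
      rcases setLoc_loc_eq hq with ⟨rfl, hl⟩ | ⟨hqp, hq⟩
      · simp at hl
      · exact ((h.floor hq).map gops gle).snoc (h.tracks.of_reading hq).lt_length.le _ }

/-- The block of the write that `q` invoked at position `k`, without reads. -/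
def newBlock (q : Fin n) (k : ℕ) (v : V) (ts : Stamp n) : Block n V := ⟨some (q, k), v, ts, []⟩

theorem newBlock_ops (q : Fin n) (k : ℕ) (v : V) (ts : Stamp n) :
    (newBlock q k v ts).ops = [SeqOp.write q k v] := rfl

/-- Lists, in an unspecified order, one block for each scanning writer selected by `P`. -/
theorem exists_batch (s : Config n V) (id : Fin n → ℕ) (P : Fin n → Prop) :
    ∃ T : List (Block n V),
      (∀ b ∈ T, ∃ q v i ts, P q ∧ s.loc q = Local.writing v i ts ∧ b = newBlock q (id q) v ts) ∧
      (∀ q v i ts, P q → s.loc q = Local.writing v i ts → newBlock q (id q) v ts ∈ T) ∧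
      (T.map Block.write).Nodup := by
  classical
  let Q := Finset.univ.filter fun q => P q ∧ ∃ v i ts, s.loc q = Local.writing v i ts
  have hQ : ∀ q : Q, ∃ b : Block n V,
      ∃ v i ts, s.loc q = Local.writing v i ts ∧ b = newBlock q (id q) v ts := fun q => by
    obtain ⟨v, i, ts, h⟩ := (Finset.mem_filter.1 q.2).2.2
    exact ⟨_, v, i, ts, h, rfl⟩
  choose f hf using hQ
  refine ⟨Finset.univ.toList.map f, fun b hb => ?_, fun q v i ts hP hq => ?_, ?_⟩
  · obtain ⟨q, -, rfl⟩ := List.mem_map.1 hb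
    obtain ⟨v, i, ts, h, hb⟩ := hf q
    exact ⟨q, v, i, ts, (Finset.mem_filter.1 q.2).2.1, h, hb⟩
  · have hqQ : q ∈ Q := Finset.mem_filter.2 ⟨Finset.mem_univ _, hP, v, i, ts, hq⟩
    obtain ⟨v', i', ts', h, hb⟩ := hf ⟨q, hqQ⟩
    obtain ⟨rfl, rfl, rfl⟩ : v = v' ∧ i = i' ∧ ts = ts' := by simpa [hq] using h
    exact List.mem_map.2 ⟨⟨q, hqQ⟩, by simp, hb⟩
  · rw [List.map_map]
    refine (Finset.nodup_toList _).map fun q q' hqq => Subtype.ext ?_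
    obtain ⟨v, i, ts, -, hb⟩ := hf q
    obtain ⟨v', i', ts', -, hb'⟩ := hf q'
    simp only [Function.comp_apply, hb, hb', newBlock, Option.some.injEq, Prod.mk.injEq] at hqq
    exact hqq.1

theorem IsArrangement.append_blocks (h : IsArrangement H (seqOf B)) {T : List (Block n V)}
    (hT : ∀ b ∈ T, ∃ q v ts, Pending H q (id q) (RegOp.write v) ∧
      (∀ b' ∈ B, b'.write ≠ some (q, id q)) ∧ b = newBlock q (id q) v ts)
    (hnd : (T.map Block.write).Nodup) : IsArrangement H (seqOf (B ++ T)) := by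
  rw [seqOf_append]
  refine h.append_pending ?_ (fun e he x hx hxe => ?_) fun e he => ?_
  · rw [List.Nodup, List.pairwise_map, seqOf, List.pairwise_flatMap]
    refine ⟨fun b hb => ?_, (List.pairwise_map.1 hnd).imp_of_mem fun hb hb' hne x hx y hy hxy => ?_⟩
    · obtain ⟨q, v, ts, -, -, rfl⟩ := hT b hb
      simp [newBlock_ops]
    · obtain ⟨q, v, ts, hP, -, rfl⟩ := hT _ hb
      obtain ⟨q', v', ts', hP', -, rfl⟩ := hT _ hb'
      simp only [newBlock_ops, List.mem_singleton] at hx hy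
      subst hx hy
      simp only [SeqOp.ident] at hxy
      exact hne (by simp [newBlock, (hxy ▸ hP).proc_eq hP'])
  · obtain ⟨b, hb, heb⟩ := mem_seqOf.1 he
    obtain ⟨q, v, ts, hP, hnew, rfl⟩ := hT b hb
    rw [newBlock_ops, List.mem_singleton] at heb
    subst heb
    simp only [SeqOp.ident] at hxe
    obtain ⟨b', hb', hw⟩ := h.exists_block hx (hxe ▸ hP.1)
    exact hnew b' hb' (hxe ▸ hw)
  · obtain ⟨b, hb, heb⟩ := mem_seqOf.1 he
    obtain ⟨q, v, ts, hP, hnew, rfl⟩ := hT b hb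
    rw [newBlock_ops, List.mem_singleton] at heb
    subst heb
    exact hP

theorem setVal_setLoc_val_le (hb : StampBounds s) {p : Fin n} {v : V} {ts : Stamp n}
    (hp : s.loc p = Local.writing v n ts) (j : Fin n) :
    toLex (s.val j).2 ≤ toLex (((s.setVal p (v, ts)).setLoc p Local.written).val j).2 := by
  by_cases hj : j = p
  · subst hj
    simpa [Config.setLoc, Config.setVal] using (hb.val_lt hp).le
  · simp [Config.setLoc, Config.setVal, hj]

theorem Tracks.store (h : Tracks H s id) {p : Fin n} {v : V} {ts : Stamp n}
    (hp : s.loc p = Local.writing v n ts) :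
    Tracks (H ++ [Event.baseWrite p (v, ts)]) ((s.setVal p (v, ts)).setLoc p Local.written) id := by
  refine h.internal (by simp) (by simp) (fun q hq => ?_) fun q o hq => ?_ <;>
  · by_cases hqp : q = p
    · subst hqp
      simp_all [Executes, setLoc_loc_self]
    · rwa [setLoc_loc_of_ne _ _ hqp]

theorem store_val_self (s : Config n V) (p : Fin n) (c : Cell n V) :
    ((s.setVal p c).setLoc p Local.written).val p = c := by
  simp [Config.setLoc, Config.setVal]

theorem store_val_of_ne (s : Config n V) {p j : Fin n} (c : Cell n V) (h : j ≠ p) :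
    ((s.setVal p c).setLoc p Local.written).val j = s.val j := by
  simp [Config.setLoc, Config.setVal, h]

/-- The block `b₀` already carries the stamp `ts`, which is at most the current maximum; the block
list stays as it is. -/
theorem Simulates.store_committed (h : Simulates v₀ H s id B) {p : Fin n} {v : V} {ts : Stamp n}
    (hp : s.loc p = Local.writing v n ts) {b₀ : Block n V} (hb₀ : b₀ ∈ B)
    (hw₀ : b₀.write = some (p, id p)) :
    Simulates v₀ (H ++ [Event.baseWrite p (v, ts)])
      ((s.setVal p (v, ts)).setLoc p Local.written) id B where
  bounds := h.bounds.store hp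
  tracks := h.tracks.store hp
  arrangement := h.arrangement.snoc_of_not_resp (by simp)
  consistent := h.consistent
  ne_nil := h.ne_nil
  top := by
    obtain ⟨m, ⟨j, rfl⟩, hm, hB, hlt⟩ := h.top
    have hts := hB b₀ hb₀
    rw [h.committed hp b₀ hb₀ hw₀] at hts
    have hj : j ≠ p := by
      rintro rfl
      -- The old contents of `Val[p]` lie below `ts ≤ m`, so the maximum is held elsewhere and
      -- survives the overwriting.
      exact ((h.bounds.val_lt hp).trans_le hts).false
    refine ⟨_, ⟨j, by rw [store_val_of_ne _ _ hj]⟩, fun k => ?_, hB, hlt⟩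
    by_cases hk : k = p
    · subst hk
      rwa [store_val_self]
    · rw [store_val_of_ne _ _ hk]
      exact hm k
  uncommitted {q w i t} hq := by
    rcases setLoc_loc_eq hq with ⟨rfl, hl⟩ | ⟨hqp, hq⟩
    · simp at hl
    · exact h.uncommitted hq
  committed {q w i t} hq := by
    rcases setLoc_loc_eq hq with ⟨rfl, hl⟩ | ⟨hqp, hq⟩
    · simp at hl
    · exact h.committed hq
  cell c hc := by
    have hc' : c = (v, ts) ∨
        ((∃ j, s.val j = c) ∨ ∃ q cs, s.loc q = Local.reading cs ∧ c ∈ cs) := by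
      rcases hc with ⟨j, rfl⟩ | ⟨q, cs, hq, hcs⟩
      · by_cases hj : j = p
        · subst hj
          exact Or.inl (store_val_self _ _ _)
        · exact Or.inr (Or.inl ⟨j, (store_val_of_ne _ _ hj).symm⟩)
      · rcases setLoc_loc_eq hq with ⟨rfl, hl⟩ | ⟨-, hq⟩
        · simp at hl
        · exact Or.inr (Or.inr ⟨q, cs, hq, hcs⟩)
    rcases hc' with rfl | hc'
    · refine ⟨b₀, hb₀, ?_, h.committed hp b₀ hb₀ hw₀, fun q w i t hq => ?_⟩
      · simpa using (h.arrangement.invoked_block hb₀ hw₀).symm.trans (h.tracks.of_writing hp).1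
      · rcases setLoc_loc_eq hq with ⟨rfl, hl⟩ | ⟨hqp, -⟩
        · simp at hl
        · simp [hw₀, Ne.symm hqp]
    · obtain ⟨b, hb, hv, hs, hw⟩ := h.cell c hc'
      refine ⟨b, hb, hv, hs, fun q w i t hq => ?_⟩
      rcases setLoc_loc_eq hq with ⟨rfl, hl⟩ | ⟨hqp, hq⟩
      · simp at hl
      · exact hw q w i t hq
  written q hq := by
    rcases setLoc_loc_eq hq with ⟨rfl, hl⟩ | ⟨hqp, hq⟩
    · exact ⟨b₀, hb₀, hw₀⟩
    · exact h.written q hq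
  read_new {q cs} hq := by
    rcases setLoc_loc_eq hq with ⟨rfl, hl⟩ | ⟨hqp, hq⟩
    · simp at hl
    · exact h.read_new hq
  floor {q cs} hq := by
    rcases setLoc_loc_eq hq with ⟨rfl, hl⟩ | ⟨hqp, hq⟩
    · simp at hl
    · exact ((h.floor hq).mono_val (setVal_setLoc_val_le h.bounds hp)).snoc
        (h.tracks.of_reading hq).lt_length.le _

/-- The commit point. Since `ts` exceeds all earlier blocks and the whole batch, it becomes the
strict maximum once its own block is put last. The batch removes exactly those uncommitted writes
that would violate `uncommitted` for this new maximum. -/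
theorem Simulates.store_uncommitted (h : Simulates v₀ H s id B) {p : Fin n} {v : V} {ts : Stamp n}
    (hp : s.loc p = Local.writing v n ts) (hu : ∀ b ∈ B, b.write ≠ some (p, id p)) :
    ∃ B', B.map Block.key <+: B'.map Block.key ∧
      Simulates v₀ (H ++ [Event.baseWrite p (v, ts)])
        ((s.setVal p (v, ts)).setLoc p Local.written) id B' := by
  obtain ⟨T, hT, hTmem, hTnd⟩ := exists_batch s id fun q =>
    q ≠ p ∧ (∀ b ∈ B, b.write ≠ some (q, id q)) ∧
      ∀ w i t, s.loc q = Local.writing w i t → toLex t < toLex ts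
  set T' := T ++ [newBlock p (id p) v ts] with hT'
  have hTlt : ∀ b ∈ T, toLex b.stamp < toLex ts := fun b hb => by
    obtain ⟨q, w, i, t, ⟨-, -, hlt⟩, hq, rfl⟩ := hT b hb
    exact hlt w i t hq
  have hT'w : ∀ b ∈ T', ∃ q w i t, s.loc q = Local.writing w i t ∧
      (∀ b' ∈ B, b'.write ≠ some (q, id q)) ∧ b = newBlock q (id q) w t := fun b hb => by
    rcases List.mem_append.1 hb with hb | hb
    · obtain ⟨q, w, i, t, ⟨-, hq', -⟩, hq, rfl⟩ := hT b hb
      exact ⟨q, w, i, t, hq, hq', rfl⟩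
    · exact ⟨p, v, n, ts, hp, hu, List.mem_singleton.1 hb⟩
  have hT'P : ∀ b ∈ T', ∃ q w t, Pending H q (id q) (RegOp.write w) ∧
      (∀ b' ∈ B, b'.write ≠ some (q, id q)) ∧ b = newBlock q (id q) w t := fun b hb => by
    obtain ⟨q, w, i, t, hq, hq', rfl⟩ := hT'w b hb
    exact ⟨q, w, t, h.tracks.of_writing hq, hq', rfl⟩
  have hT'nd : (T'.map Block.write).Nodup := by
    rw [hT', List.map_append, List.nodup_append']
    refine ⟨hTnd, by simp, fun x hx hx' => ?_⟩
    obtain ⟨b, hb, rfl⟩ := List.mem_map.1 hx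
    obtain ⟨q, w, i, t, ⟨hqp, -⟩, -, rfl⟩ := hT b hb
    simp [newBlock, hqp] at hx'
  have harr := h.arrangement.append_blocks hT'P hT'nd
  have hBlt := h.uncommitted hp hu
  have hle : ∀ b ∈ B ++ T', toLex b.stamp ≤ toLex ts := fun b hb => by
    rcases List.mem_append.1 hb with hb | hb
    · exact (hBlt b hb).le
    · rcases List.mem_append.1 hb with hb | hb
      · exact (hTlt b hb).le
      · rw [List.mem_singleton.1 hb]
        exact le_rfl
  have hmem : newBlock p (id p) v ts ∈ B ++ T' := by simp [hT']
  refine ⟨B ++ T', by simp, ?_⟩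
  exact
  { bounds := h.bounds.store hp
    tracks := h.tracks.store hp
    arrangement := harr.snoc_of_not_resp (by simp)
    consistent := by
      rw [List.map_append]
      refine h.consistent.append fun k hk => ?_
      obtain ⟨b, hb, rfl⟩ := List.mem_map.1 hk
      obtain ⟨q, w, t, -, -, rfl⟩ := hT'P b hb
      simp [newBlock, Block.key]
    ne_nil := by simp [h.ne_nil]
    top := by
      obtain ⟨m, ⟨j, rfl⟩, hm, hB, hlt⟩ := h.top
      refine ⟨ts, ⟨p, by rw [store_val_self]⟩, fun k => ?_, hle, fun k b hb hk => ?_⟩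
      · by_cases hk : k = p
        · subst hk
          rw [store_val_self]
        · rw [store_val_of_ne _ _ hk]
          obtain ⟨c, hc, -, hcs, -⟩ := h.cell (s.val k) (Or.inl ⟨k, rfl⟩)
          exact hcs ▸ (hBlt c hc).le
      · rw [hT', ← List.append_assoc] at hb hk
        rw [List.getElem?_append_left (by simp at hk ⊢; omega)] at hb
        rcases List.mem_append.1 (List.mem_of_getElem? hb) with hb | hb
        · exact hBlt b hb
        · exact hTlt b hb
    uncommitted := by
      intro q w i t hq hu' b hb
      rcases setLoc_loc_eq hq with ⟨rfl, hl⟩ | ⟨hqp, hq⟩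
      · simp at hl
      refine (hle b hb).trans_lt (lt_of_le_of_ne (not_lt.1 fun hlt => ?_) fun heq => ?_)
      -- A smaller partial timestamp would have put `q` into the batch.
      · refine hu' (newBlock q (id q) w t) (List.mem_append_right _ (List.mem_append_left _ ?_)) rfl
        refine hTmem q w i t ⟨hqp, fun b hb => hu' b (List.mem_append_left _ hb), ?_⟩ hq
        intro w' i' t' hq'
        obtain ⟨rfl, rfl, rfl⟩ : w = w' ∧ i = i' ∧ t = t' := by
          simpa using hq.symm.trans hq'
        exact hlt
      -- Equality fails at coordinate `q`: `ts q` is at most the stored diagonal entry, which is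
      -- below `t q`.
      · have h₁ := h.bounds.store_le hp q hqp
        rw [toLex.injective heq] at h₁
        exact (h₁.trans_lt (h.bounds.own_lt hq)).false
    committed := by
      intro q w i t hq b hb hbq
      rcases setLoc_loc_eq hq with ⟨rfl, hl⟩ | ⟨hqp, hq⟩
      · simp at hl
      rcases List.mem_append.1 hb with hb | hb
      · exact h.committed hq b hb hbq
      · obtain ⟨q', w', i', t', hq', -, rfl⟩ := hT'w b hb
        obtain rfl : q' = q := by
          simp only [newBlock, Option.some.injEq, Prod.mk.injEq] at hbq
          exact hbq.1
        obtain ⟨rfl, rfl, rfl⟩ : w = w' ∧ i = i' ∧ t = t' := by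
          simpa using hq.symm.trans hq'
        rfl
    cell := fun c hc => by
      have hc' : c = (v, ts) ∨
          ((∃ j, s.val j = c) ∨ ∃ q cs, s.loc q = Local.reading cs ∧ c ∈ cs) := by
        rcases hc with ⟨j, rfl⟩ | ⟨q, cs, hq, hcs⟩
        · by_cases hj : j = p
          · subst hj
            exact Or.inl (store_val_self _ _ _)
          · exact Or.inr (Or.inl ⟨j, (store_val_of_ne _ _ hj).symm⟩)
        · rcases setLoc_loc_eq hq with ⟨rfl, hl⟩ | ⟨-, hq⟩
          · simp at hl
          · exact Or.inr (Or.inr ⟨q, cs, hq, hcs⟩)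
      rcases hc' with rfl | hc'
      · refine ⟨_, hmem, rfl, rfl, fun q w i t hq => ?_⟩
        rcases setLoc_loc_eq hq with ⟨rfl, hl⟩ | ⟨hqp, -⟩
        · simp at hl
        · simp [newBlock, Ne.symm hqp]
      · obtain ⟨b, hb, hv, hs, hw⟩ := h.cell c hc'
        refine ⟨b, List.mem_append_left _ hb, hv, hs, fun q w i t hq => ?_⟩
        rcases setLoc_loc_eq hq with ⟨rfl, hl⟩ | ⟨hqp, hq⟩
        · simp at hl
        · exact hw q w i t hq
    written := fun q hq => by
      rcases setLoc_loc_eq hq with ⟨rfl, hl⟩ | ⟨hqp, hq⟩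
      · exact ⟨_, hmem, rfl⟩
      · obtain ⟨b, hb, hbq⟩ := h.written q hq
        exact ⟨b, List.mem_append_left _ hb, hbq⟩
    read_new := by
      intro q cs hq e he heq
      rcases setLoc_loc_eq hq with ⟨rfl, hl⟩ | ⟨hqp, hq⟩
      · simp at hl
      rw [seqOf_append] at he
      rcases List.mem_append.1 he with he | he
      · exact h.read_new hq e he heq
      · obtain ⟨b, hb, heb⟩ := mem_seqOf.1 he
        obtain ⟨q', w, t, hP, -, rfl⟩ := hT'P b hb
        rw [newBlock_ops, List.mem_singleton] at heb
        subst heb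
        have := (h.tracks.of_reading hq).1.symm.trans ((show id q' = id q from heq) ▸ hP.1)
        simp at this
    floor := by
      intro q cs hq
      rcases setLoc_loc_eq hq with ⟨rfl, hl⟩ | ⟨hqp, hq⟩
      · simp at hl
      refine (((h.floor hq).mono_val (setVal_setLoc_val_le h.bounds hp)).append
        fun b hb e he hpre => ?_).snoc (h.tracks.of_reading hq).lt_length.le _
      obtain ⟨q', w, t, hP, -, rfl⟩ := hT'P b hb
      rw [newBlock_ops, List.mem_singleton] at he
      subst he
      exact hP.not_completeIn hpre.completeIn }

/-- The read goes to the end of the block `b` of the returned tuple; `Floor` guarantees that no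
operation behind it precedes the read. -/
theorem Simulates.readReturn (h : Simulates v₀ H s id B) {p : Fin n} {cs : List (Cell n V)}
    {c : Cell n V} (hp : s.loc p = Local.reading cs) (hlen : cs.length = n) (hc : c ∈ cs)
    (hmax : ∀ c' ∈ cs, toLex c'.2 ≤ toLex c.2) :
    ∃ B' : List (Block n V), B'.map Block.key = B.map Block.key ∧
      Simulates v₀ (H ++ [Event.resp p (RegResp.val c.1)]) (s.setLoc p Local.idle) id B' := by
  obtain ⟨b, hb, hbv, hbs, -⟩ := h.cell c (Or.inr ⟨p, cs, hp, hc⟩)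
  obtain ⟨i, hi⟩ := List.mem_iff_getElem?.1 hb
  obtain ⟨hil, hib⟩ := List.getElem?_eq_some_iff.1 hi
  have hP := h.tracks.of_reading hp
  set b' : Block n V := { b with reads := b.reads ++ [(p, id p)] } with hb'
  have hops : b'.ops = b.ops ++ [SeqOp.read p (id p) c.1] := by
    simp [hb', Block.ops, Block.key, hbv]
  set X := seqOf (B.take i) ++ b.ops
  set Y := seqOf (B.drop (i + 1))
  have hB : seqOf B = X ++ Y := by
    have : B = B.take i ++ b :: B.drop (i + 1) := by
      rw [← hib, List.getElem_cons_drop, List.take_append_drop]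
    conv_lhs => rw [this, seqOf_append]
    simp [X, Y, seqOf]
  have hB' : seqOf (B.set i b') = X ++ SeqOp.read p (id p) c.1 :: Y := by
    rw [List.set_eq_take_append_cons_drop, if_pos hil, seqOf_append]
    simp [X, Y, seqOf, hops]
  have hY : ∀ y ∈ Y, ¬ Precedes H y.ident (id p) := by
    obtain ⟨a, m, j, ha, h₁, h₂, h₃, -⟩ := h.floor hp
    -- The witness register has been collected with a stamp of at least `m`, and `c` is maximal, so
    -- its block cannot be among those with stamps below `m`.
    have hai : a ≤ i := by
      by_contra hlt
      have hj := List.getElem?_eq_getElem (l := cs) (i := j) (by omega)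
      have := (h₁ i b (by omega) hi).trans_le
        ((h₃ _ hj).trans (hmax _ (List.getElem_mem _)))
      rw [hbs] at this
      exact this.false
    intro y hy
    obtain ⟨d, hd, hyd⟩ := mem_seqOf.1 hy
    obtain ⟨k, hk⟩ := List.mem_iff_getElem?.1 hd
    rw [List.getElem?_drop] at hk
    exact h₂ _ d (by omega) hk y hyd
  have hnew := h.read_new hp
  have harr : IsArrangement H (seqOf (B.set i b')) := by
    rw [hB']
    exact IsArrangement.insert (hB ▸ h.arrangement) (e := SeqOp.read p (id p) c.1) hP (hB ▸ hnew) hY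
  have hkeys : (B.set i b').map Block.key = B.map Block.key := by
    have : b'.key = (B.map Block.key)[i]'(by simpa using hil) := by simp [hib, hb', Block.key]
    rw [List.map_set, this, List.set_getElem_self]
  have hmem : ∀ d' ∈ B.set i b', ∃ d ∈ B, d'.write = d.write ∧ d'.stamp = d.stamp := by
    intro d' hd'
    rcases List.mem_or_eq_of_mem_set hd' with hd' | rfl
    · exact ⟨d', hd', rfl, rfl⟩
    · exact ⟨b, hb, rfl, rfl⟩
  have hmem' : ∀ d ∈ B, ∃ d' ∈ B.set i b',
      d'.write = d.write ∧ d'.stamp = d.stamp ∧ d'.val = d.val := by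
    intro d hd
    obtain ⟨k, hk⟩ := List.mem_iff_getElem?.1 hd
    by_cases hki : i = k
    · subst hki
      obtain rfl : b = d := by simpa [hi] using hk
      exact ⟨b', List.mem_set hil _, rfl, rfl, rfl⟩
    · exact ⟨d, List.mem_of_getElem? ((List.getElem?_set_ne hki).trans hk), rfl, rfl, rfl⟩
  refine ⟨B.set i b', hkeys, ?_⟩
  exact
  { bounds := h.bounds.step (Step.readReturn s p cs c hp hlen hc hmax)
    tracks := h.tracks.respond (by simp [hp]) _
    arrangement := by
      refine harr.snoc_resp (h.tracks.onlyPending p)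
        ⟨SeqOp.read p (id p) c.1, by simp [hB'], rfl⟩ fun e he hep => ?_
      rw [hB'] at he
      have he' : e = SeqOp.read p (id p) c.1 ∨ e ∈ X ++ Y := by
        simp only [List.mem_append, List.mem_cons] at he ⊢
        tauto
      rcases he' with rfl | he'
      · rfl
      · exact absurd hep (hnew e (hB ▸ he'))
    consistent := by
      rw [hkeys]
      exact h.consistent
    ne_nil := by simpa using h.ne_nil
    top := by
      obtain ⟨m, hj, hm, hB, hlt⟩ := h.top
      refine ⟨m, hj, hm, fun d' hd' => ?_, fun k d' hd' hk => ?_⟩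
      · obtain ⟨d, hd, -, hs⟩ := hmem d' hd'
        exact hs ▸ hB d hd
      · rw [List.length_set] at hk
        by_cases hki : i = k
        · subst hki
          rw [List.getElem?_set_self hil] at hd'
          obtain rfl : b' = d' := by simpa using hd'
          exact hlt i b hi hk
        · rw [List.getElem?_set_ne hki] at hd'
          exact hlt k d' hd' hk
    uncommitted := by
      intro q w k t hq hu d' hd'
      rcases setLoc_loc_eq hq with ⟨rfl, hl⟩ | ⟨hqp, hq⟩
      · simp at hl
      obtain ⟨d, hd, -, hs⟩ := hmem d' hd'
      refine hs ▸ h.uncommitted hq (fun x hx => ?_) d hd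
      obtain ⟨x', hx', hw, -⟩ := hmem' x hx
      exact hw ▸ hu x' hx'
    committed := by
      intro q w k t hq d' hd' hw'
      rcases setLoc_loc_eq hq with ⟨rfl, hl⟩ | ⟨hqp, hq⟩
      · simp at hl
      obtain ⟨d, hd, hw, hs⟩ := hmem d' hd'
      exact hs ▸ h.committed hq d hd (hw ▸ hw')
    cell := fun c' hc' => by
      obtain ⟨d, hd, hv, hs, hw⟩ := h.cell c' <| hc'.imp_right fun ⟨q, cs, hq, hcs⟩ => by
        rcases setLoc_loc_eq hq with ⟨rfl, hl⟩ | ⟨-, hq⟩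
        · simp at hl
        · exact ⟨q, cs, hq, hcs⟩
      obtain ⟨d', hd', hw', hs', hv'⟩ := hmem' d hd
      refine ⟨d', hd', hv'.trans hv, hs'.trans hs, fun q w k t hq => ?_⟩
      rcases setLoc_loc_eq hq with ⟨rfl, hl⟩ | ⟨hqp, hq⟩
      · simp at hl
      · exact hw' ▸ hw q w k t hq
    written := fun q hq => by
      rcases setLoc_loc_eq hq with ⟨rfl, hl⟩ | ⟨hqp, hq⟩
      · simp at hl
      obtain ⟨d, hd, hw⟩ := h.written q hq
      obtain ⟨d', hd', hw', -⟩ := hmem' d hd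
      exact ⟨d', hd', hw'.trans hw⟩
    read_new := by
      intro q cs' hq e he heq
      rcases setLoc_loc_eq hq with ⟨rfl, hl⟩ | ⟨hqp, hq⟩
      · simp at hl
      rw [hB'] at he
      have he' : e = SeqOp.read p (id p) c.1 ∨ e ∈ X ++ Y := by
        simp only [List.mem_append, List.mem_cons] at he ⊢
        tauto
      rcases he' with rfl | he'
      · exact hqp ((h.tracks.of_reading hq).proc_eq ((show id p = id q from heq) ▸ hP))
      · exact h.read_new hq e (hB ▸ he') heq
    floor := by
      intro q cs' hq
      rcases setLoc_loc_eq hq with ⟨rfl, hl⟩ | ⟨hqp, hq⟩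
      · simp at hl
      refine ((h.floor hq).set (b' := b') hi rfl fun e he => ?_).snoc (h.tracks.of_reading hq).lt_length.le _
      rw [hops, List.mem_append, List.mem_singleton] at he
      refine he.imp_right ?_
      rintro rfl hpre
      exact hP.not_completeIn hpre.completeIn }

theorem Simulates.step (h : Simulates v₀ H s id B) {e : Event n V} {s' : Config n V}
    (hs : Step s e s') : ∃ id' B', B.map Block.key <+: B'.map Block.key ∧
      Simulates v₀ (H ++ [e]) s' id' B' := by
  cases hs with
  | invWrite p v hp => exact ⟨_, B, List.prefix_rfl, h.invWrite hp⟩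
  | writeScan p v i ts hp =>
    obtain ⟨B', hk, h'⟩ := h.writeScan hp
    exact ⟨id, B', hk ▸ List.prefix_rfl, h'⟩
  | writeStore p v ts hp =>
    by_cases hu : ∀ b ∈ B, b.write ≠ some (p, id p)
    · exact ⟨id, h.store_uncommitted hp hu⟩
    · push Not at hu
      obtain ⟨b, hb, hw⟩ := hu
      exact ⟨id, B, List.prefix_rfl, h.store_committed hp hb hw⟩
  | writeReturn p hp => exact ⟨id, B, List.prefix_rfl, h.writeReturn hp⟩
  | invRead p hp => exact ⟨_, B, List.prefix_rfl, h.invRead hp⟩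
  | readScan p i cs hp hi => exact ⟨id, B, List.prefix_rfl, h.readScan hp hi⟩
  | readReturn p cs c hp hlen hc hmax =>
    obtain ⟨B', hk, h'⟩ := h.readReturn hp hlen hc hmax
    exact ⟨id, B', hk ▸ List.prefix_rfl, h'⟩

end Simulation

/-! ### From the simulation to a write strong-linearization function. -/

section WriteStrong

variable {n : ℕ} {V : Type*}

/-- Recursion along the history: each prefix receives one fixed choice, and every extension
continues from it, which is what makes the choices coherent on a tree of histories. -/
theorem exists_prefix_monotone_choice {α β γ : Type*} (P : List α → β → Prop) (φ : β → List γ)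
    (S : Set (List α)) (hS : ∀ H e, H ++ [e] ∈ S → H ∈ S) (b₀ : β) (h₀ : P [] b₀)
    (hstep : ∀ H e b, H ++ [e] ∈ S → P H b → ∃ b', φ b <+: φ b' ∧ P (H ++ [e]) b') :
    ∃ f : List α → β, (∀ H ∈ S, P H (f H)) ∧ ∀ G H, G <+: H → φ (f G) <+: φ (f H) := by
  classical
  let nxt : List α → α → β → β := fun H e b =>
    -- Keeping `b` as the default makes `φ ∘ f` monotone even outside `S`.
    if h : ∃ b', φ b <+: φ b' ∧ P (H ++ [e]) b' then h.choose else b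
  let f : List α → β := fun H =>
    List.reverseRecOn (motive := fun _ => β) H b₀ fun H e b => nxt H e b
  have hf : ∀ H e, f (H ++ [e]) = nxt H e (f H) := fun H e => by
    simp only [f, List.reverseRecOn_concat]
  have hmono : ∀ H e, φ (f H) <+: φ (f (H ++ [e])) := fun H e => by
    rw [hf]
    by_cases h : ∃ b', φ (f H) <+: φ b' ∧ P (H ++ [e]) b'
    · simp only [nxt, dif_pos h]
      exact h.choose_spec.1
    · simp only [nxt, dif_neg h]
      exact List.prefix_rfl
  refine ⟨f, fun H => ?_, ?_⟩
  · induction H using List.reverseRecOn with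
    | nil => exact fun _ => by simpa [f] using h₀
    | append_singleton H e ih =>
      intro hH
      have h := hstep H e (f H) hH (ih (hS H e hH))
      rw [hf]
      simp only [nxt, dif_pos h]
      exact h.choose_spec.2
  · rintro G _ ⟨T, rfl⟩
    induction T using List.reverseRecOn with
    | nil => simp
    | append_singleton T e ih =>
      rw [← List.append_assoc]
      exact ih.trans (hmono _ _)

theorem writeStronglyLinearizable_histories (v₀ : V) (hn : 0 < n) :
    WriteStronglyLinearizable v₀ (histories n v₀) := by
  obtain ⟨f, hf, hmono⟩ := exists_prefix_monotone_choice
    -- The predicate may speak only of the history, so it ranges over all configurations reached by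
    -- `H`; by `Run.unique` there is at most one.
    (fun H B => ∀ s, Run v₀ H s → ∃ id, Simulates v₀ H s id B)
    (fun B : List (Block n V) => B.map Block.key) (histories n v₀)
    (fun H e ⟨s, hs⟩ => hs.exists_of_snoc.imp fun _ => And.left) _
    (fun s hs => ⟨fun _ => 0, hs.unique Run.nil ▸ Simulates.init v₀ hn _⟩)
    (fun H e B ⟨s', hs'⟩ hB => by
      obtain ⟨s, hs, hse⟩ := hs'.exists_of_snoc
      obtain ⟨id, h⟩ := hB s hs
      obtain ⟨id', B', hk, h'⟩ := h.step hse
      exact ⟨B', hk, fun s'' hs'' => ⟨id', hs'.unique hs'' ▸ h'⟩⟩)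
  refine ⟨fun H => seqOf (f H), fun H hH => ?_, fun G _ H _ hGH => ?_⟩
  · obtain ⟨s, hs⟩ := hH
    obtain ⟨id, h⟩ := hf H ⟨s, hs⟩ s hs
    exact h.arrangement.isLinearization h.consistent.readsLast
  · rw [filter_isWrite_seqOf, filter_isWrite_seqOf]
    obtain ⟨K, hK⟩ := hmono G H hGH
    exact ⟨K.flatMap keyOps, by rw [← hK, List.flatMap_append]⟩

end WriteStrong

/-! ### The branching histories that exclude strong linearizability. -/

section NotStrong

variable {n : ℕ} {V : Type*} {v₀ : V}

theorem lastValue_eq_of_forall_write {v x : V} {S : SeqHistory n V}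
    (hS : ∀ p k y, SeqOp.write p k y ∈ S → y = v)
    (h : (∃ p k y, SeqOp.write p k y ∈ S) ∨ x = v) : lastValue x S = v := by
  induction S generalizing x with
  | nil => simpa [lastValue] using h
  | cons e S ih =>
    have hS' : ∀ p k y, SeqOp.write p k y ∈ S → y = v := fun p k y hy =>
      hS p k y (List.mem_cons_of_mem _ hy)
    cases e with
    | read q j w =>
      refine ih (x := x) hS' ?_
      simpa using h
    | write q j w => exact ih (x := w) hS' (Or.inr (hS q j w (by simp)))

/-- If a write of `v` is complete in `G`, and `G` has an extension in which only `v` is written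
but some read returns the initial value, and an extension in which the same read returns `v`, then
there is no strong linearization function. -/
theorem not_stronglyLinearizable_of_extensions {ℋ : Set (History n V)} {v : V} (hv : v₀ ≠ v)
    {G A B : History n V} (hG : G ∈ ℋ) (hA : A ∈ ℋ) (hB : B ∈ ℋ) (hGA : G <+: A) (hGB : G <+: B)
    {k w : ℕ} {p : Fin n} (hw : CompleteIn G w)
    (hwG : G[w]? = some (Event.inv p (RegOp.write v)))
    (hAk : ∃ m, RespondsAt A k m (RegResp.val v₀))
    (hBk : ∃ m, RespondsAt B k m (RegResp.val v))
    (hAw : ∀ q y, Event.inv q (RegOp.write y) ∈ A → y = v) : ¬ StronglyLinearizable v₀ ℋ := by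
  obtain ⟨m, hAk⟩ := hAk
  obtain ⟨m', hBk⟩ := hBk
  rintro ⟨f, hf, hpre⟩
  obtain ⟨e, he, hek⟩ := (hf A hA).complete k ⟨m, _, hAk⟩
  have her := (hf A hA).response e he m _ (hek.symm ▸ hAk)
  obtain ⟨q, rfl⟩ : ∃ q, e = SeqOp.read q k v₀ := by
    cases e with
    | read q j x =>
      obtain rfl : x = v₀ := by simpa [SeqOp.resp] using her
      obtain rfl : j = k := hek
      exact ⟨q, rfl⟩
    | write q j x => simp [SeqOp.resp] at her
  obtain ⟨i, hi⟩ := List.mem_iff_getElem?.1 he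
  obtain ⟨e', he', hew⟩ := (hf G hG).complete w hw
  have hop := ((hf G hG).invoked e' he').symm.trans (hew ▸ hwG)
  obtain ⟨j, hj⟩ := List.mem_iff_getElem?.1 he'
  have hjl := (List.getElem?_eq_some_iff.1 hj).1
  obtain ⟨T, hT⟩ := hpre G hG A hA hGA
  obtain ⟨T', hT'⟩ := hpre G hG B hB hGB
  -- Is the completed write, at `j`, before the read, at `i`, in `f A`? If so, the read would have
  -- to return `v`; if not, the read already lies in `f G`, and hence in `f B` with response `v₀`.
  rcases lt_or_ge j i with hji | hij
  · have hjA : (f A)[j]? = some e' := by rw [← hT, List.getElem?_append_left hjl, hj]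
    refine hv (((hf A hA).reads i q k v₀ hi).trans (lastValue_eq_of_forall_write ?_ (Or.inl ?_)))
    · intro q' k' y hy
      exact hAw q' y (List.mem_of_getElem?
        ((hf A hA).invoked _ (List.mem_of_mem_take hy)))
    · have hmem : e' ∈ (f A).take i :=
        List.mem_of_getElem? ((List.getElem?_take_of_lt hji).trans hjA)
      cases e' with
      | read q' k' x => simp [SeqOp.op] at hop
      | write q' k' x => exact ⟨q', k', x, hmem⟩
  · have hiB : (f B)[i]? = some (SeqOp.read q k v₀) := by
      rw [← hT', List.getElem?_append_left (hij.trans_lt hjl),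
        ← List.getElem?_append_left (l₂ := T) (hij.trans_lt hjl), hT, hi]
    have := (hf B hB).response _ (List.mem_of_getElem? hiB) m' _ hBk
    exact hv (by simpa [SeqOp.resp] using this)

/-- An access to a shared register. -/
def IsAccess : Event n V → Prop
  | Event.baseRead _ _ _ => True
  | Event.baseWrite _ _ => True
  | _ => False

theorem respondsAt_append (A M C : History n V) {p : Fin n} {o : RegOp V} {r : RegResp V}
    (hM : ∀ r, Event.resp p r ∉ M) :
    RespondsAt (A ++ (Event.inv p o :: (M ++ Event.resp p r :: C))) A.length
      (A.length + (M.length + 1)) r := by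
  refine ⟨p, o, by simp, by omega, ?_, fun j hj hjm r' h => ?_⟩
  · rw [List.getElem?_append_right (by omega)]
    simp
  · obtain ⟨i, rfl⟩ : ∃ i, j = A.length + (i + 1) := ⟨j - A.length - 1, by omega⟩
    rw [List.getElem?_append_right (by omega), Nat.add_sub_cancel_left, List.getElem?_cons_succ,
      List.getElem?_append_left (by omega)] at h
    exact hM r' (List.mem_of_getElem? h)

theorem setLoc_setLoc (s : Config n V) (p : Fin n) (l l' : Local n V) :
    (s.setLoc p l).setLoc p l' = s.setLoc p l' := by
  simp [Config.setLoc]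

theorem exists_run_writeLoop {H : History n V} {s : Config n V} (h : Run v₀ H s) {p : Fin n}
    (v : V) (hp : s.loc p = Local.idle) {k : ℕ} (hk : k ≤ n) :
    ∃ L ts, Run v₀ (H ++ Event.inv p (RegOp.write v) :: L) (s.setLoc p (Local.writing v k ts)) ∧
      ∀ e ∈ L, IsAccess e := by
  induction k with
  | zero => exact ⟨[], _, h.snoc (Step.invWrite s p v hp), by simp⟩
  | succ k ih =>
    obtain ⟨L, ts, hr, hL⟩ := ih (by omega)
    have hs := Step.writeScan (s.setLoc p (Local.writing v k ts)) p v ⟨k, hk⟩ ts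
      (setLoc_loc_self _ _ _)
    rw [setLoc_setLoc] at hs
    refine ⟨L ++ [_], _, by simpa using hr.snoc hs, fun e he => ?_⟩
    rcases List.mem_append.1 he with he | he
    · exact hL e he
    · rw [List.mem_singleton.1 he]
      trivial

/-- A process that is idle can perform a complete write. -/
theorem exists_run_write {H : History n V} {s : Config n V} (h : Run v₀ H s) {p : Fin n}
    (v : V) (hp : s.loc p = Local.idle) :
    ∃ L s' ts, Run v₀ (H ++ Event.inv p (RegOp.write v) :: (L ++ [Event.resp p RegResp.done])) s' ∧
      (∀ e ∈ L, IsAccess e) ∧ s'.loc = s.loc ∧ s'.val = Function.update s.val p (v, ts) := by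
  obtain ⟨L, ts, hr, hL⟩ := exists_run_writeLoop h v hp le_rfl
  have h₁ := hr.snoc (Step.writeStore _ p v ts (setLoc_loc_self _ _ _))
  have h₂ := h₁.snoc (Step.writeReturn _ p (setLoc_loc_self _ _ _))
  refine ⟨L ++ [Event.baseWrite p (v, ts)], _, ts, by simpa using h₂, fun e he => ?_, ?_, ?_⟩
  · rcases List.mem_append.1 he with he | he
    · exact hL e he
    · rw [List.mem_singleton.1 he]
      trivial
  · simp [Config.setLoc, Config.setVal, ← hp]
  · simp [Config.setLoc, Config.setVal]

theorem exists_run_readLoop {H : History n V} {s : Config n V} (h : Run v₀ H s) {p : Fin n}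
    {cs : List (Cell n V)} (hp : s.loc p = Local.reading cs) {k : ℕ} (hk : cs.length + k ≤ n) :
    ∃ L cs', Run v₀ (H ++ L) (s.setLoc p (Local.reading cs')) ∧ (∀ e ∈ L, IsAccess e) ∧
      cs'.length = cs.length + k ∧ cs ⊆ cs' ∧
      (∀ c ∈ cs', c ∈ cs ∨ ∃ i : Fin n, cs.length ≤ i ∧ c = s.val i) ∧
      ∀ i : Fin n, cs.length ≤ i → i < cs.length + k → s.val i ∈ cs' := by
  induction k with
  | zero =>
    refine ⟨[], cs, ?_, by simp, rfl, fun _ => _root_.id, fun c hc => Or.inl hc, by omega⟩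
    have : s.setLoc p (Local.reading cs) = s := by simp [Config.setLoc, ← hp]
    simpa [this] using h
  | succ k ih =>
    obtain ⟨L, cs', hr, hL, hlen, hsub, hcs, hval⟩ := ih (by omega)
    have hs := Step.readScan (s.setLoc p (Local.reading cs')) p ⟨cs.length + k, by omega⟩ cs'
      (setLoc_loc_self _ _ _) hlen
    rw [setLoc_setLoc] at hs
    refine ⟨L ++ [_], _, by simpa using hr.snoc hs, fun e he => ?_, by simp [hlen]; omega,
      fun c hc => List.mem_append_left _ (hsub hc), fun c hc => ?_, fun i hi hik => ?_⟩
    · rcases List.mem_append.1 he with he | he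
      · exact hL e he
      · rw [List.mem_singleton.1 he]
        trivial
    · rcases List.mem_append.1 hc with hc | hc
      · exact hcs c hc
      · exact Or.inr ⟨⟨cs.length + k, by omega⟩, by simp, List.mem_singleton.1 hc⟩
    · by_cases hik' : (i : ℕ) < cs.length + k
      · exact List.mem_append_left _ (hval i hi hik')
      · have : i = ⟨cs.length + k, by omega⟩ := Fin.ext (by simp; omega)
        exact List.mem_append_right _ (by simp [Config.setLoc, this])

/-- A pending read can be completed. It returns the value of any tuple with the greatest timestamp
among those it has collected and those in the registers that it has not read yet. -/
theorem exists_run_read {H : History n V} {s : Config n V} (h : Run v₀ H s) {p : Fin n}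
    {cs : List (Cell n V)} (hp : s.loc p = Local.reading cs) (hlen : cs.length ≤ n) (c : Cell n V)
    (hc : c ∈ cs ∨ ∃ i : Fin n, cs.length ≤ i ∧ s.val i = c)
    (hcs : ∀ c' ∈ cs, c'.2 ≤ c.2) (hval : ∀ i : Fin n, cs.length ≤ i → (s.val i).2 ≤ c.2) :
    ∃ L s', Run v₀ (H ++ (L ++ [Event.resp p (RegResp.val c.1)])) s' ∧ ∀ e ∈ L, IsAccess e := by
  obtain ⟨L, cs', hr, hL, hlen', hsub, hcs', hval'⟩ :=
    exists_run_readLoop h hp (k := n - cs.length) (by omega)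
  have hr' := hr.snoc (e := Event.resp p (RegResp.val c.1)) <|
    Step.readReturn _ p cs' c (setLoc_loc_self _ _ _) (by omega) ?_ fun c' hc' => ?_
  · exact ⟨L, _, by simpa using hr', hL⟩
  · rcases hc with hc | ⟨i, hi, rfl⟩
    · exact hsub hc
    · exact hval' i hi (by omega)
  · rcases hcs' c' hc' with hc' | ⟨i, hi, rfl⟩
    · exact Pi.toLex_monotone (hcs c' hc')
    · exact Pi.toLex_monotone (hval i hi)

theorem not_stronglyLinearizable_histories [Nontrivial V] (v₀ : V) (hn : 3 ≤ n) :
    ¬ StronglyLinearizable v₀ (histories n v₀) := by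
  obtain ⟨v, hv⟩ := exists_ne v₀
  set p₁ : Fin n := ⟨0, by omega⟩ with hp₁
  set p₂ : Fin n := ⟨1, by omega⟩ with hp₂
  set p₃ : Fin n := ⟨2, by omega⟩ with hp₃
  have h₁₂ : p₁ ≠ p₂ := by simp [hp₁, hp₂]
  have h₁₃ : p₁ ≠ p₃ := by simp [hp₁, hp₃]
  have h₂₃ : p₂ ≠ p₃ := by simp [hp₂, hp₃]
  set c₀ : Cell n V := (v₀, fun _ => 0) with hc₀
  -- The read has to pass `Val[p₁]` before `p₁` stores, so that it misses this write; `Val[p₂]`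
  -- still lies ahead of it.
  have r₁ := (Run.nil (n := n) (v₀ := v₀)).snoc (Step.invRead _ p₃ rfl)
  have r₂ := r₁.snoc (Step.readScan _ p₃ p₁ [] (setLoc_loc_self _ _ _) rfl)
  rw [setLoc_setLoc] at r₂
  obtain ⟨L₁, s₁, ts₁, r₃, hL₁, hloc₁, hval₁⟩ := exists_run_write r₂ (p := p₁) v
    (by rw [setLoc_loc_of_ne _ _ h₁₃]; rfl)
  have hread₁ : s₁.loc p₃ = Local.reading [c₀] := by
    rw [hloc₁, setLoc_loc_self]
    rfl
  have hval₁' : ∀ i : Fin n, 1 ≤ (i : ℕ) → s₁.val i = c₀ := fun i hi => by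
    have : i ≠ p₁ := by rintro rfl; simp [hp₁] at hi
    rw [hval₁, Function.update_of_ne this]
    rfl
  obtain ⟨LA, sA, rA, hLA⟩ := exists_run_read r₃ hread₁ (by simp; omega) c₀ (by simp) (by simp)
    fun i hi => by rw [hval₁' i hi]
  obtain ⟨L₂, s₂, ts₂, r₄, hL₂, hloc₂, hval₂⟩ := exists_run_write r₃ (p := p₂) v
    (by rw [hloc₁, setLoc_loc_of_ne _ _ h₂₃]; rfl)
  have hread₂ : s₂.loc p₃ = Local.reading [c₀] := by rw [hloc₂, hread₁]
  -- The value of `ts₂` is irrelevant: all other tuples available to the read have the zero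
  -- timestamp, which is below anything.
  obtain ⟨LB, sB, rB, hLB⟩ := exists_run_read r₄ hread₂ (by simp; omega) (v, ts₂)
    (Or.inr ⟨p₂, by simp [hp₂], by simp [hval₂]⟩) (by simp [hc₀, Pi.le_def]) fun i hi => by
      by_cases hi₂ : i = p₂
      · simp [hval₂, hi₂]
      · rw [hval₂, Function.update_of_ne hi₂, hval₁' i hi]
        exact fun _ => bot_le
  have hacc : ∀ {L : History n V}, (∀ e ∈ L, IsAccess e) →
      (∀ p r, Event.resp p r ∉ L) ∧ ∀ p o, Event.inv p o ∉ L := fun hL =>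
    ⟨fun p r h => hL _ h, fun p o h => hL _ h⟩
  have hread : ∀ {r : RegResp V} (M : History n V), (∀ r, Event.resp p₃ r ∉ M) →
      ∀ A, A = Event.inv p₃ RegOp.read :: (M ++ [Event.resp p₃ r]) → ∃ m, RespondsAt A 0 m r := by
    rintro r M hM _ rfl
    exact ⟨_, respondsAt_append [] M [] hM⟩
  refine not_stronglyLinearizable_of_extensions hv.symm ⟨_, r₃⟩ ⟨_, rA⟩ ⟨_, rB⟩
    (List.prefix_append _ _) ⟨_, (List.append_assoc _ _ _).symm⟩
    -- Position `0` is the invocation of the read, position `1` its access to `Val[p₁]`, and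
    -- position `2` the invocation of the write of `p₁`.
    (k := 0) (w := 2) (p := p₁) ⟨_, _, respondsAt_append _ L₁ [] ((hacc hL₁).1 p₁)⟩ (by simp)
    (hread (Event.baseRead p₃ p₁ c₀ :: Event.inv p₁ (RegOp.write v) ::
      (L₁ ++ Event.resp p₁ RegResp.done :: LA)) ?_ _ (by simp [hc₀, Config.setLoc, Config.init]))
    (hread (Event.baseRead p₃ p₁ c₀ :: Event.inv p₁ (RegOp.write v) ::
      (L₁ ++ Event.resp p₁ RegResp.done :: Event.inv p₂ (RegOp.write v) ::
      (L₂ ++ Event.resp p₂ RegResp.done :: LB))) ?_ _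
      (by simp [hc₀, Config.setLoc, Config.init])) ?_
  · simp [(hacc hL₁).1, (hacc hLA).1, h₁₃.symm]
  · simp [(hacc hL₁).1, (hacc hL₂).1, (hacc hLB).1, h₁₃.symm, h₂₃.symm]
  · simp [(hacc hL₁).2, (hacc hLA).2]

end NotStrong

end RegisterLin

theorem mainTheorem8 {V : Type*} [Nontrivial V] (v₀ : V) (n : ℕ) (hn : 3 ≤ n) :
    -- the algorithm is not strongly linearizable
    ¬ RegisterLin.StronglyLinearizable v₀ (RegisterLin.VectorClock.histories n v₀) ∧
    -- strong linearizability implies write strong-linearizability, and this is strict: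
    -- the algorithm is write strongly-linearizable
    (∀ ℋ : Set (RegisterLin.History n V),
      RegisterLin.StronglyLinearizable v₀ ℋ → RegisterLin.WriteStronglyLinearizable v₀ ℋ) ∧
    RegisterLin.WriteStronglyLinearizable v₀ (RegisterLin.VectorClock.histories n v₀) :=
  ⟨RegisterLin.not_stronglyLinearizable_histories v₀ hn,
    fun _ ⟨f, hf, hpre⟩ => ⟨f, hf, fun G hG H hH hGH => (hpre G hG H hH hGH).filter _⟩,
    RegisterLin.writeStronglyLinearizable_histories v₀ (by omega)⟩
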